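/- \textbf{Setting.} Let $S$ be a countable set, $m\ge 1$, and let $(x_1,\dots,x_m)\in S^m$ be a pattern. Its \emph{overlap size} is the largest $\ell\in\{0,\dots,m-1\}$ with $(x_1,\dots,x_\ell)=(x_{m-\ell+1},\dots,x_m)$; the pattern \emph{contains no overlap} if its overlap size is $0$. Along a sequence $X_0,X_1,X_2,\dots$ in $S$ the pattern is observed with a fresh start after each observation: $\tau_0:=0$, and for $j\ge 0$, $\tau_{j+1}$ is the least $n\ge\tau_j+m$ with $(X_{n-m+1},\dots,X_n)=(x_1,\dots,x_m)$ ($\tau_{j+1}:=\infty$ if there is none), so that the $m$ entries of the new occurrence all come strictly after time $\tau_j$. Let $T_j:=\tau_{j+1}-\tau_j$ be the waiting time from the $j$-th to the next observation. \textbf{Theorem (Pattern Occurrence for Discrete-State Markov Chain).} Let $X_0,X_1,X_2,\dots$ be a time-homogeneous Markov chain on $S$ with transition matrix $P$ and arbitrary initial distribution, and suppose that $P$ has exactly one stationary probability distribution $\pi$. Let $\mu(x,y)\in[1,\infty]$ be the mean of $\min\{n\ge 1: X_n=y\}$ for the chain started at $x$ (so $\mu(y,y)$ is the mean return time). Assume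 $\pi_{x_1}\prod_{i=1}^{m-1}P_{x_i,x_{i+1}}>0$. Then $\mu(x_m,x_1)<\infty$, and the following holds for every $j\ge 0$ and every $x_0\in S$ such that the event $B=\{\tau_j<\infty,\ X_{\tau_j}=x_0\}$ has positive probability (for $j=0$, $B=\{X_0=x_0\}$; for $j\ge1$ necessarily $x_0=x_m$). \begin{itemize} \item If $(x_1,\dots,x_m)$ contains no overlap, then $$\mathbb E[T_j\mid B]=\frac{1}{\pi_{x_1}\prod_{i=1}^{m-1}P_{x_i,x_{i+1}}}+\mu(x_0,x_1)-\mu(x_m,x_1).$$ \item If $(x_1,\dots,x_m)$ has overlap size $k\ge 1$ and $(x_1,\dots,x_k)$ itself contains no overlap, then $$\mathbb E[T_j\mid B]=\frac{1}{\pi_{x_1}\prod_{i=1}^{m-1}P_{x_i,x_{i+1}}}+\frac{1}{\pi_{x_1}\prod_{i=1}^{k-1}P_{x_i,x_{i+1}}}+\mu(x_0,x_1)-\mu(x_m,x_1).$$ \end{itemize} Both sides are $+\infty$ when $\mu(x_0,x_1)=\infty$. \textbf{The iid case.} Let $X_1,X_2,\dots$ be iid with values in $S$ and $p_a:=\mathbb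 P(X_i=a)$, and assume $\prod_{i=1}^m p_{x_i}>0$. Then for every $j\ge 0$: if $(x_1,\dots,x_m)$ contains no overlap, $\mathbb E[T_j]=1/\prod_{i=1}^m p_{x_i}$; if it has overlap size $k\ge1$ and $(x_1,\dots,x_k)$ contains no overlap, then $\mathbb E[T_j]=1/\prod_{i=1}^m p_{x_i}+1/\prod_{i=1}^k p_{x_i}$. -/

import Mathlib

open MeasureTheory ProbabilityTheory
open scoped ENNReal

namespace PatternOccurrence

section Patterns

variable {S : Type*}

/-- The pattern `(x 1, …, x m)` has overlap size `k`: `k` is the largest `ℓ < m` such that the first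
`ℓ` entries coincide with the last `ℓ` entries (`k = 0` is the trivial, empty overlap).
Only the values `x 1, …, x m` matter. -/
def HasOverlapOfSize (x : ℕ → S) (m k : ℕ) : Prop :=
  IsGreatest {l : ℕ | l < m ∧ ∀ i ∈ Finset.Icc 1 l, x i = x (m - l + i)} k

/-- The pattern `(x 1, …, x m)` contains no overlap: its largest overlap is empty. -/
def NoOverlap (x : ℕ → S) (m : ℕ) : Prop := HasOverlapOfSize x m 0

/-- `obsTime x m y j` is the time of the `j`-th observation of the pattern `(x 1, …, x m)` along
the trajectory `y`, where the observation starts at time `0` and is restarted after each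
occurrence of the pattern: the `(j+1)`-st observation happens at the first time `n` such that
`(y (n-m+1), …, y n) = (x 1, …, x m)` and these `m` entries all come strictly after the `j`-th
observation time. It is `⊤` if there is no such time. -/
noncomputable def obsTime (x : ℕ → S) (m : ℕ) (y : ℕ → S) : ℕ → ℕ∞
  | 0 => 0
  | j + 1 => sInf {t : ℕ∞ | ∃ n : ℕ, t = (n : ℕ∞) ∧ obsTime x m y j + (m : ℕ∞) ≤ (n : ℕ∞) ∧
      ∀ i ∈ Finset.Icc 1 m, y (n - m + i) = x i}

/-- The waiting time `T` from the `j`-th to the `(j+1)`-st observation of the pattern (for `j = 0`,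
from time `0` to the first observation). -/
noncomputable def waitTime (x : ℕ → S) (m : ℕ) (y : ℕ → S) (j : ℕ) : ℕ∞ :=
  obsTime x m y (j + 1) - obsTime x m y j

/-- The `j`-th observation takes place (at a finite time), and the trajectory is then in
state `a`. For `j = 0` this says that `y 0 = a`. -/
def ObservedInState (x : ℕ → S) (m : ℕ) (y : ℕ → S) (j : ℕ) (a : S) : Prop :=
  ∃ t : ℕ, obsTime x m y j = (t : ℕ∞) ∧ y t = a

/-- The first time `n ≥ 1` at which the trajectory `y` is in state `b`
(the return time if `y 0 = b`). -/
noncomputable def hitTime (b : S) (y : ℕ → S) : ℕ∞ :=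
  sInf {t : ℕ∞ | ∃ n : ℕ, t = (n : ℕ∞) ∧ 1 ≤ n ∧ y n = b}

end Patterns

section Chains

variable {S : Type*}

/-- `P a b` is the probability of a transition from `a` to `b`, so the rows of `P` are probability
mass functions. `π` is the stationary distribution of `P`: it satisfies `π P = π`, and it is the
only probability mass function that does. -/
def IsTheStationaryDistribution (P : S → PMF S) (π : PMF S) : Prop :=
  π.bind P = π ∧ ∀ ρ : PMF S, ρ.bind P = ρ → ρ = π

/-- `X 0, X 1, X 2, …` is a time-homogeneous Markov chain with transition matrix `P`
(and arbitrary initial distribution). -/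
def IsMarkovChain {Ω : Type*} [MeasurableSpace Ω] [MeasurableSpace S]
    (P : S → PMF S) (X : ℕ → Ω → S) (μ : Measure Ω) : Prop :=
  (∀ n, Measurable (X n)) ∧
    ∀ (n : ℕ) (s : ℕ → S),
      μ {ω | ∀ i ≤ n + 1, X i ω = s i} = μ {ω | ∀ i ≤ n, X i ω = s i} * P (s n) (s (n + 1))

variable [Countable S] [MeasurableSpace S] [MeasurableSingletonClass S]

/-- The law of the next state given the states at the times `0, …, n`. -/
noncomputable def stepKernel (P : S → PMF S) (n : ℕ) :
    Kernel ((i : Finset.Iic n) → (fun _ : ℕ => S) i) S :=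
  (Kernel.ofFunOfCountable fun a : S => (P a).toMeasure).comap
    (fun h => h ⟨n, Finset.mem_Iic.2 le_rfl⟩) (measurable_pi_apply _)

instance (P : S → PMF S) (n : ℕ) : IsMarkovKernel (stepKernel P n) := by
  have : IsMarkovKernel (Kernel.ofFunOfCountable fun a : S => (P a).toMeasure) :=
    ⟨fun a => inferInstanceAs (IsProbabilityMeasure (P a).toMeasure)⟩
  unfold stepKernel
  infer_instance

/-- The law on trajectories of the Markov chain with transition matrix `P` started at `a`. -/
noncomputable def chainLaw (P : S → PMF S) (a : S) : Measure (ℕ → S) :=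
  Kernel.traj (X := fun _ : ℕ => S) (stepKernel P) 0 (fun _ => a)

/-- The mean time that the Markov chain takes to reach `b` from `a`, in at least one step
(the mean return time if `a = b`). -/
noncomputable def meanHitTime (P : S → PMF S) (a b : S) : ℝ≥0∞ :=
  ∫⁻ y, (hitTime b y : ℝ≥0∞) ∂(chainLaw P a)

end Chains

end PatternOccurrence

/-! Let T be the first observation time for the chain started at a, q the probability that T is
finite, and V the mean number of visits to x₁ at times 1, …, T. The first visit to x₁ after T occurs
at T plus a fresh hitting time from x_m; it also occurs at the first hitting time of x₁ plus one
return time for each visit counted by V. The Markov property turns this into Wald's identity E T + q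
μ(x_m,x₁) = μ(a,x₁) + V μ(x₁,x₁) (`lintegral_obsTime_add`), and Kac's formula gives μ(x₁,x₁) =
1/π(x₁) (`IsTheStationaryDistribution.meanHitTime_self`).

Each visit counted by V is followed by the rest of the pattern with probability K = ∏
P(x_i,x_{i+1}), so V K is the mean number of occurrences beginning at times 1, …, T. Without
overlap, the observed occurrence is the only one, and V K = q (`meanVisits_mul_of_noOverlap`). With
overlap size k and a prefix of length k free of overlap, the only other candidate begins with the
last k observed letters; it is completed with probability R = ∏_{k≤i<m} P(x_i,x_{i+1}), so V K = q(1
+ R) (`meanVisits_mul_of_overlap`). Here R/K is the reciprocal of the product over the prefix. If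
μ(a,x₁) is finite, then V is finite, hence so is E T, and q = 1; if it is infinite, so is E T.

After each observation the chain starts afresh (`IsMarkovLaw.setLIntegral_waitTime`), which covers
every j. In the iid case all rows of P equal p and the state at time 0 is irrelevant; starting at
x_m makes the two hitting times cancel. -/

namespace PatternOccurrence

/-! ### Events decided by finitely many coordinates -/

section Events

variable {S : Type*}

/-- `shift n y` is the trajectory `y` seen from time `n` on. -/
def shift (n : ℕ) (y : ℕ → S) : ℕ → S := fun i => y (n + i)

/-- Membership in `A` can be decided at time `n`. -/
abbrev KnownAt (n : ℕ) (A : Set (ℕ → S)) : Prop := DependsOn (fun y => y ∈ A) (Set.Iic n)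

theorem KnownAt.eq_preimage {n : ℕ} {A : Set (ℕ → S)} (hA : KnownAt n A) :
    A = Preorder.frestrictLe (π := fun _ => S) n ⁻¹'
      (Preorder.frestrictLe (π := fun _ => S) n '' A) := by
  refine Set.Subset.antisymm (Set.subset_preimage_image _ _) ?_
  rintro y ⟨z, hz, hzy⟩
  have : (z ∈ A) = (y ∈ A) := hA fun i hi => congrFun hzy ⟨i, Finset.mem_Iic.2 hi⟩
  exact this ▸ hz

theorem exists_extension {n : ℕ} (w : (i : Finset.Iic n) → S) :
    ∃ s : ℕ → S, Preorder.frestrictLe (π := fun _ => S) n s = w ∧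
      Preorder.frestrictLe (π := fun _ => S) n ⁻¹' {w} = {y | ∀ i ≤ n, y i = s i} := by
  -- The values after time n are arbitrary; the entry of `w` at 0 only supplies an element of S.
  refine ⟨fun i => if h : i ≤ n then w ⟨i, Finset.mem_Iic.2 h⟩ else w ⟨0, by simp⟩, ?_, ?_⟩
  · ext i
    have := Finset.mem_Iic.1 i.2
    simp [this]
  · ext y
    simp only [Set.mem_preimage, Set.mem_singleton_iff, Set.mem_ofPred_eq, funext_iff]
    constructor
    · intro h i hi
      simpa [hi] using h ⟨i, Finset.mem_Iic.2 hi⟩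
    · intro h i
      have hi := Finset.mem_Iic.1 i.2
      simpa [hi] using h i hi

theorem KnownAt.mono {n k : ℕ} {A : Set (ℕ → S)} (hA : KnownAt n A) (h : n ≤ k) : KnownAt k A :=
  fun _ _ hyz => hA fun i hi => hyz i (le_trans hi h)

theorem KnownAt.inter {n : ℕ} {A B : Set (ℕ → S)} (hA : KnownAt n A) (hB : KnownAt n B) :
    KnownAt n (A ∩ B) :=
  fun _ _ hyz => congrArg₂ And (hA hyz) (hB hyz)

theorem knownAt_of_forall {n : ℕ} {A : Set (ℕ → S)}
    (h : ∀ y z : ℕ → S, (∀ i ≤ n, y i = z i) → y ∈ A → z ∈ A) : KnownAt n A :=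
  fun y z hyz => propext ⟨h y z hyz, h z y fun i hi => (hyz i hi).symm⟩

theorem knownAt_state {n i : ℕ} (hi : i ≤ n) (b : S) : KnownAt n {y | y i = b} :=
  knownAt_of_forall fun _ _ hyz hy => (hyz i hi).symm.trans hy

end Events

/-! ### Markov laws on trajectory space and the Markov property -/

section MarkovLaws

variable {S : Type*} [Countable S] [MeasurableSpace S] [MeasurableSingletonClass S]

/-- Under the law `ν` the coordinates form a Markov chain with transition matrix `P`. -/
abbrev IsMarkovLaw (P : S → PMF S) (ν : Measure (ℕ → S)) : Prop :=
  IsMarkovChain P (fun n y => y n) ν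

theorem KnownAt.measurableSet {n : ℕ} {A : Set (ℕ → S)} (hA : KnownAt n A) :
    MeasurableSet A := by
  rw [hA.eq_preimage]
  exact Preorder.measurable_frestrictLe n (Set.to_countable _).measurableSet

theorem measurable_shift {S : Type*} [MeasurableSpace S] (n : ℕ) :
    Measurable (shift (S := S) n) :=
  measurable_pi_lambda _ fun i => measurable_pi_apply (n + i)

/-- The Markov property for one step, given an event known at time `n`. -/
theorem IsMarkovLaw.measure_inter_next {P : S → PMF S} {ν : Measure (ℕ → S)}
    (hν : IsMarkovLaw P ν) {n : ℕ} {A : Set (ℕ → S)} (hA : KnownAt n A) {a : S}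
    (ha : ∀ y ∈ A, y n = a) (b : S) :
    ν (A ∩ {y | y (n + 1) = b}) = ν A * P a b := by
  set f := Preorder.frestrictLe (π := fun _ : ℕ => S) n with hf
  have mf : Measurable f := Preorder.measurable_frestrictLe n
  set g : ((i : Finset.Iic n) → S) → ℝ≥0∞ := fun w => P (w ⟨n, by simp⟩) b with hg
  have mg : Measurable g := measurable_of_countable g
  -- The histories up to time n form a countable set, so this density identity can be tested on
  -- single histories, where it is the defining equation of the chain. Integrating it over the image
  -- of A gives the claim.
  have key : (ν.restrict {y | y (n + 1) = b}).map f = (ν.map f).withDensity g := by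
    refine Measure.ext_of_singleton fun w => ?_
    obtain ⟨s, hs, hw⟩ := exists_extension w
    have hs' : w ⟨n, by simp⟩ = s n := by rw [← hs]; rfl
    rw [Measure.map_apply mf (measurableSet_singleton w), withDensity_apply _
      (measurableSet_singleton w), lintegral_singleton, Measure.map_apply mf
      (measurableSet_singleton w), Measure.restrict_apply (mf (measurableSet_singleton w)), hw, hg]
    have := hν.2 n (fun i => if i ≤ n then s i else b)
    simp only [le_refl, if_true, Nat.not_succ_le_self, if_false] at this
    have e1 : {y : ℕ → S | ∀ i ≤ n, y i = if i ≤ n then s i else b} = {y | ∀ i ≤ n, y i = s i} := by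
      ext y
      refine forall₂_congr fun i hi => ?_
      simp [hi]
    have e2 : {y : ℕ → S | ∀ i ≤ n + 1, y i = if i ≤ n then s i else b} =
        {y | ∀ i ≤ n, y i = s i} ∩ {y | y (n + 1) = b} := by
      ext y
      constructor
      · intro h
        refine ⟨fun i hi => ?_, ?_⟩
        · simpa [hi] using h i (by omega)
        · simpa using h (n + 1) le_rfl
      · rintro ⟨h1, h2⟩ i hi
        rcases Nat.le_succ_iff.1 hi with h | h
        · simpa [h] using h1 i h
        · subst h; simpa using h2
    rw [e1, e2] at this
    rw [this, ← hs', mul_comm]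
  have mC : MeasurableSet (f '' A) := (Set.to_countable _).measurableSet
  have := congrArg (fun ρ => ρ (f '' A)) key
  rw [Measure.map_apply mf mC, ← hA.eq_preimage, Measure.restrict_apply hA.measurableSet,
    withDensity_apply _ mC, setLIntegral_map mC mg mf, ← hA.eq_preimage,
    setLIntegral_congr_fun hA.measurableSet (g := fun _ => P a b)] at this
  · rw [this, setLIntegral_const, mul_comm]
  · intro y hy
    change P (y n) b = P a b
    rw [ha y hy]

/-- A Markov law is determined by its transition matrix and its initial distribution. -/
theorem IsMarkovLaw.ext {P : S → PMF S} {ν₁ ν₂ : Measure (ℕ → S)} [IsFiniteMeasure ν₁]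
    (h₁ : IsMarkovLaw P ν₁) (h₂ : IsMarkovLaw P ν₂)
    (h : ∀ a, ν₁ {y | y 0 = a} = ν₂ {y | y 0 = a}) : ν₁ = ν₂ := by
  have cyl : ∀ (n : ℕ) (s : ℕ → S),
      ν₁ {y | ∀ i ≤ n, y i = s i} = ν₂ {y | ∀ i ≤ n, y i = s i} := by
    intro n
    induction n with
    | zero => intro s; simpa using h (s 0)
    | succ n ih => intro s; rw [h₁.2, h₂.2, ih]
  let F : (I : Finset ℕ) → Measure ((i : I) → S) := fun I => ν₁.map I.restrict
  have hF : IsProjectiveLimit (α := fun _ => S) ν₁ F := fun I => rfl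
  have hF' : IsProjectiveMeasureFamily (α := fun _ => S) F := by
    intro I J hJI
    simp only [F]
    rw [Measure.map_map (Finset.measurable_restrict₂ hJI) (Finset.measurable_restrict I)]
    rfl
  have : ∀ I, IsFiniteMeasure (F I) := fun I => by simp only [F]; infer_instance
  -- A projective limit of finite measures is unique, and along ℕ it is determined by the initial
  -- segments.
  refine hF.unique ((isProjectiveLimit_nat_iff (X := fun _ => S) hF' ν₂).2 fun n => ?_)
  have mf := Preorder.measurable_frestrictLe (X := fun _ : ℕ => S) n
  change _ = ν₁.map (Preorder.frestrictLe n)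
  refine Measure.ext_of_singleton fun w => ?_
  obtain ⟨s, -, hw⟩ := exists_extension w
  rw [Measure.map_apply mf (measurableSet_singleton w),
    Measure.map_apply mf (measurableSet_singleton w), hw, cyl]

instance (P : S → PMF S) (a : S) : IsProbabilityMeasure (chainLaw P a) := by
  unfold chainLaw; infer_instance

theorem chainLaw_start (P : S → PMF S) (a : S) : ∀ᵐ y ∂chainLaw P a, y 0 = a := by
  have h := Kernel.traj_map_frestrictLe_apply (X := fun _ => S) (κ := stepKernel P) 0 0 (fun _ => a)
  rw [Kernel.partialTraj_self, Kernel.id_apply] at h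
  have mf := Preorder.measurable_frestrictLe (X := fun _ : ℕ => S) 0
  have h2 := congrArg (fun ρ => ρ {w | w ⟨0, by simp⟩ = a}ᶜ) h
  have mC : MeasurableSet ({w : (i : Finset.Iic 0) → S | w ⟨0, by simp⟩ = a}ᶜ) :=
    (Set.to_countable _).measurableSet
  rw [Measure.map_apply mf mC, Measure.dirac_apply' _ mC] at h2
  rw [ae_iff]
  refine Eq.trans ?_ (h2.trans ?_)
  · rfl
  · simp

theorem chainLaw_isMarkovLaw (P : S → PMF S) (a : S) : IsMarkovLaw P (chainLaw P a) := by
  refine ⟨fun n => measurable_pi_apply n, fun n s => ?_⟩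
  have h := Kernel.partialTraj_compProd_eq_map_traj (X := fun _ => S)
    (κ := stepKernel P) (Nat.zero_le n)
    (x₀ := fun _ => a)
  have mf := Preorder.measurable_frestrictLe (X := fun _ : ℕ => S) n
  have h1 := congrArg (fun ρ => ρ ({Preorder.frestrictLe (π := fun _ => S) n s} ×ˢ {s (n + 1)})) h
  have m1 := measurableSet_singleton (Preorder.frestrictLe (π := fun _ => S) n s)
  have m2 := measurableSet_singleton (s (n + 1))
  rw [Measure.compProd_apply_prod m1 m2, lintegral_singleton,
    Measure.map_apply (mf.prodMk (measurable_pi_apply (n + 1))) (m1.prod m2),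
    ← Kernel.traj_map_frestrictLe_apply, Measure.map_apply mf m1] at h1
  have e0 : Preorder.frestrictLe (π := fun _ => S) n ⁻¹' {Preorder.frestrictLe (π := fun _ => S) n s}
      = {y | ∀ i ≤ n, y i = s i} := by
    ext y
    simp only [Set.mem_preimage, Set.mem_singleton_iff, Set.mem_ofPred_eq, funext_iff]
    exact ⟨fun h i hi => h ⟨i, Finset.mem_Iic.2 hi⟩, fun h i => h i (Finset.mem_Iic.1 i.2)⟩
  have e1 : stepKernel P n (Preorder.frestrictLe (π := fun _ => S) n s) {s (n + 1)}
      = P (s n) (s (n + 1)) :=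
    PMF.toMeasure_apply_singleton _ _ m2
  have e2 : (fun y : ℕ → S => (Preorder.frestrictLe (π := fun _ => S) n y, y (n + 1))) ⁻¹'
      ({Preorder.frestrictLe (π := fun _ => S) n s} ×ˢ {s (n + 1)})
      = {y | ∀ i ≤ n + 1, y i = s i} := by
    have : (fun y : ℕ → S => (Preorder.frestrictLe (π := fun _ => S) n y, y (n + 1))) ⁻¹'
      ({Preorder.frestrictLe (π := fun _ => S) n s} ×ˢ {s (n + 1)}) =
      (Preorder.frestrictLe (π := fun _ => S) n ⁻¹' {Preorder.frestrictLe (π := fun _ => S) n s})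
        ∩ {y | y (n + 1) = s (n + 1)} := rfl
    rw [this, e0]
    ext y
    constructor
    · rintro ⟨h1, h2⟩ i hi
      rcases Nat.le_succ_iff.1 hi with h | h
      · exact h1 i h
      · subst h; exact h2
    · intro h
      exact ⟨fun i hi => h i (by omega), h _ le_rfl⟩
  rw [e0, e1, e2] at h1
  unfold chainLaw
  rw [← h1, mul_comm]

/-- The Markov property: given an event known at time `n` on which the chain is in state `a` at
time `n`, the future is a chain started at `a`. -/
theorem IsMarkovLaw.map_shift_restrict {P : S → PMF S} {ν : Measure (ℕ → S)} [IsFiniteMeasure ν]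
    (hν : IsMarkovLaw P ν) {n : ℕ} {A : Set (ℕ → S)} (hA : KnownAt n A) {a : S}
    (ha : ∀ y ∈ A, y n = a) :
    (ν.restrict A).map (shift n) = ν A • chainLaw P a := by
  have mA := hA.measurableSet
  have mcyl : ∀ (k : ℕ) (s : ℕ → S), MeasurableSet {y : ℕ → S | ∀ i ≤ k, y i = s i} := fun k s =>
    (knownAt_of_forall (n := k) fun y z hyz (hy : ∀ i ≤ k, y i = s i) i hi =>
      (hyz i hi).symm.trans (hy i hi)).measurableSet
  have hap : ∀ E : Set (ℕ → S), MeasurableSet E →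
      (ν.restrict A).map (shift n) E = ν (A ∩ shift n ⁻¹' E) := fun E mE => by
    rw [Measure.map_apply (measurable_shift n) mE, Measure.restrict_apply (measurable_shift n mE),
      Set.inter_comm]
  -- Both sides satisfy the Markov equation and put mass ν A on the initial state a. Without
  -- normalization the case ν A = 0 needs no separate treatment.
  refine IsMarkovLaw.ext (P := P) ⟨fun n => measurable_pi_apply n, fun k s => ?_⟩
    ⟨fun n => measurable_pi_apply n, fun k s => ?_⟩ fun b => ?_
  · rw [hap _ (mcyl _ s), hap _ (mcyl _ s)]
    have hK : KnownAt (n + k) (A ∩ shift n ⁻¹' {y | ∀ i ≤ k, y i = s i}) :=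
      (hA.mono (by omega)).inter (knownAt_of_forall fun y z hyz (hy : ∀ i ≤ k, y (n + i) = s i)
        i hi => (hyz (n + i) (by omega)).symm.trans (hy i hi))
    rw [← hν.measure_inter_next hK (a := s k) (fun y hy => hy.2 k le_rfl)]
    congr 1
    ext y
    constructor
    · rintro ⟨h1, h2⟩
      exact ⟨⟨h1, fun i hi => h2 i (by omega)⟩, h2 (k + 1) le_rfl⟩
    · rintro ⟨⟨h1, h2⟩, h3⟩
      refine ⟨h1, fun i hi => ?_⟩
      rcases Nat.le_succ_iff.1 hi with h | h
      · exact h2 i h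
      · subst h; exact h3
  · simp only [Measure.smul_apply, smul_eq_mul]
    rw [(chainLaw_isMarkovLaw P a).2 k s, mul_assoc]
  · rw [hap _ (knownAt_state le_rfl b).measurableSet, Measure.smul_apply]
    have h0 : shift n ⁻¹' {y | y 0 = b} = {y | y n = b} := rfl
    rw [h0]
    have hs := chainLaw_start P a
    by_cases hab : b = a
    · subst hab
      have h1 : chainLaw P b {y | y 0 = b} = 1 :=
        (prob_compl_eq_zero_iff (knownAt_state (n := 0) le_rfl b).measurableSet).1 hs
      have h2 : A ∩ {y | y n = b} = A := Set.inter_eq_left.2 ha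
      rw [h1, h2, smul_eq_mul, mul_one]
    · have e : A ∩ {y | y n = b} = ∅ := by
        ext y
        simp only [Set.mem_inter_iff, Set.mem_ofPred_eq, Set.mem_empty_iff_false, iff_false, not_and]
        intro hy hb
        exact hab (hb.symm.trans (ha y hy))
      have : chainLaw P a {y | y 0 = b} = 0 := by
        refine measure_mono_null ?_ hs
        intro y hy h
        exact hab (hy.symm.trans h)
      rw [e, this]
      simp

theorem IsMarkovLaw.setLIntegral_shift {P : S → PMF S} {ν : Measure (ℕ → S)} [IsFiniteMeasure ν]
    (hν : IsMarkovLaw P ν) {n : ℕ} {A : Set (ℕ → S)} (hA : KnownAt n A) {a : S}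
    (ha : ∀ y ∈ A, y n = a) {f : (ℕ → S) → ℝ≥0∞} (hf : Measurable f) :
    ∫⁻ y in A, f (shift n y) ∂ν = ν A * ∫⁻ y, f y ∂chainLaw P a := by
  rw [← lintegral_map hf (measurable_shift n), hν.map_shift_restrict hA ha, lintegral_smul_measure,
    smul_eq_mul]

end MarkovLaws

/-! ### First times with values in ℕ∞ -/

section FirstTimes

/-- The least `n` satisfying `p`, `⊤` if there is none. -/
noncomputable def firstTime (p : ℕ → Prop) : ℕ∞ := sInf {t : ℕ∞ | ∃ n : ℕ, t = (n : ℕ∞) ∧ p n}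

theorem le_firstTime_iff {p : ℕ → Prop} {t : ℕ∞} : t ≤ firstTime p ↔ ∀ n, p n → t ≤ n := by
  rw [firstTime, le_sInf_iff]
  exact ⟨fun h n hn => h _ ⟨n, rfl, hn⟩, by rintro h _ ⟨n, rfl, hn⟩; exact h n hn⟩

theorem firstTime_le {p : ℕ → Prop} {n : ℕ} (hn : p n) : firstTime p ≤ n :=
  sInf_le ⟨n, rfl, hn⟩

theorem firstTime_eq_coe_iff {p : ℕ → Prop} {n : ℕ} :
    firstTime p = n ↔ p n ∧ ∀ k < n, ¬p k := by
  constructor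
  · intro h
    have hlow : ∀ k < n, ¬p k := fun k hk hp => by
      have := firstTime_le hp
      rw [h] at this
      exact absurd (Nat.cast_le.1 this) (by omega)
    refine ⟨?_, hlow⟩
    by_contra hn
    have : ((n + 1 : ℕ) : ℕ∞) ≤ firstTime p := le_firstTime_iff.2 fun k hk => by
      refine Nat.cast_le.2 ?_
      rcases lt_trichotomy k n with h' | h' | h'
      · exact absurd hk (hlow k h')
      · exact absurd (h' ▸ hk) hn
      · exact h'
    rw [h] at this
    exact absurd (Nat.cast_le.1 this) (by omega)
  · rintro ⟨h1, h2⟩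
    refine le_antisymm (firstTime_le h1) (le_firstTime_iff.2 fun k hk => Nat.cast_le.2 ?_)
    by_contra hlt
    exact h2 k (by omega) hk

theorem firstTime_eq_top_iff {p : ℕ → Prop} : firstTime p = ⊤ ↔ ∀ n, ¬p n := by
  rw [← top_le_iff, le_firstTime_iff]
  exact forall_congr' fun n => by simp

theorem firstTime_eq_add {p : ℕ → Prop} {t : ℕ} (h : ∀ n, p n → t ≤ n) :
    firstTime p = t + firstTime (fun n => p (t + n)) := by
  generalize hq : firstTime (fun n => p (t + n)) = u
  induction u using ENat.recTopCoe with
  | top =>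
    rw [firstTime_eq_top_iff] at hq
    rw [add_top, firstTime_eq_top_iff]
    intro n hn
    refine hq (n - t) ?_
    rwa [Nat.add_sub_cancel' (h n hn)]
  | coe u =>
    rw [firstTime_eq_coe_iff] at hq
    rw [← Nat.cast_add, firstTime_eq_coe_iff]
    refine ⟨hq.1, fun k hk hp => hq.2 (k - t) ?_ ?_⟩
    · have := h k hp; omega
    · rwa [Nat.add_sub_cancel' (h k hp)]

end FirstTimes

/-! ### Pathwise identities for hitting and observation times -/

section Paths

variable {S : Type*}

theorem shift_shift (n k : ℕ) (y : ℕ → S) : shift n (shift k y) = shift (k + n) y :=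
  funext fun i => congrArg y (add_assoc k n i).symm

theorem hitTime_of_eq {b : S} {y : ℕ → S} (h : y 1 = b) : hitTime b y = 1 :=
  (firstTime_eq_coe_iff (p := fun n => 1 ≤ n ∧ y n = b) (n := 1)).2
    ⟨⟨le_rfl, h⟩, fun _ hk hp => absurd hp.1 (by omega)⟩

theorem hitTime_of_ne {b : S} {y : ℕ → S} (h : y 1 ≠ b) :
    hitTime b y = 1 + hitTime b (shift 1 y) := by
  have := firstTime_eq_add (p := fun n => 1 ≤ n ∧ y n = b) (t := 1) fun n hn => hn.1
  refine this.trans ?_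
  rw [Nat.cast_one]
  refine congrArg (1 + ·) (congrArg firstTime (funext fun n => propext ?_))
  refine ⟨fun hn => ⟨?_, hn.2⟩, fun hn => ⟨by omega, hn.2⟩⟩
  rcases Nat.eq_zero_or_pos n with rfl | h0
  · exact absurd hn.2 h
  · exact h0

theorem lt_hitTime_iff {b : S} {y : ℕ → S} {n : ℕ} :
    (n : ℕ∞) < hitTime b y ↔ ∀ i, 1 ≤ i → i ≤ n → y i ≠ b := by
  rw [← ENat.add_one_le_iff (ENat.natCast_ne_top n)]
  refine (le_firstTime_iff (p := fun n => 1 ≤ n ∧ y n = b)).trans ⟨fun h i h1 h2 h3 => ?_,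
    fun h i hi => ?_⟩
  · have := h i ⟨h1, h3⟩
    rw [← Nat.cast_one, ← Nat.cast_add, Nat.cast_le] at this
    omega
  · rw [← Nat.cast_one, ← Nat.cast_add, Nat.cast_le]
    by_contra hlt
    exact h i hi.1 (by omega) hi.2

theorem knownAt_hitTime (b : S) (n : ℕ) : KnownAt n {y : ℕ → S | hitTime b y = n} := by
  refine knownAt_of_forall fun y z hyz hy => ?_
  have h := (firstTime_eq_coe_iff (p := fun n => 1 ≤ n ∧ y n = b)).1 hy
  refine (firstTime_eq_coe_iff (p := fun n => 1 ≤ n ∧ z n = b)).2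
    ⟨⟨h.1.1, (hyz n le_rfl).symm.trans h.1.2⟩, fun k hk hz => h.2 k hk ⟨hz.1, ?_⟩⟩
  exact (hyz k hk.le).trans hz.2

/-- Counting the time until the first visit to `b` after a deterministic time `t`. -/
theorem add_hitTime_shift [DecidableEq S] (b : S) (y : ℕ → S) (t : ℕ) :
    (t : ℝ≥0∞) + (hitTime b (shift t y) : ℝ≥0∞) = (hitTime b y : ℝ≥0∞) +
      ∑ s ∈ Finset.range t, if y (s + 1) = b then (hitTime b (shift (s + 1) y) : ℝ≥0∞) else 0 := by
  induction t with
  | zero =>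
    have : shift 0 y = y := funext fun i => congrArg y (zero_add i)
    simp [this]
  | succ t ih =>
    rw [Finset.sum_range_succ, ← add_assoc, ← ih]
    have hs : shift 1 (shift t y) = shift (t + 1) y := shift_shift 1 t y
    -- One step uses up one unit of the current hitting time. If it lands in b, that time is
    -- exhausted and a new one opens, which is the new summand.
    by_cases h : y (t + 1) = b
    · rw [hitTime_of_eq (y := shift t y) h, if_pos h]
      push_cast
      rfl
    · rw [hitTime_of_ne (y := shift t y) h, if_neg h, hs]
      push_cast
      ring

/-- Counting the time until the first visit to `b` after an arbitrary random time `T`. -/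
theorem add_tsum_hitTime_shift [DecidableEq S] (b : S) (y : ℕ → S) (T : ℕ∞) :
    (T : ℝ≥0∞) + ∑' t : ℕ, (if T = t then (hitTime b (shift t y) : ℝ≥0∞) else 0) =
      (hitTime b y : ℝ≥0∞) + ∑' s : ℕ, if ((s + 1 : ℕ) : ℕ∞) ≤ T ∧ y (s + 1) = b then
        (hitTime b (shift (s + 1) y) : ℝ≥0∞) else 0 := by
  induction T using ENat.recTopCoe with
  | top =>
    -- If T is infinite, the right side exceeds every natural number t, by the count up to the
    -- deterministic time t.
    rw [ENat.toENNReal_top, top_add, eq_comm, eq_top_iff]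
    refine le_of_forall_lt fun c hc => ?_
    obtain ⟨t, ht⟩ := ENNReal.exists_nat_gt hc.ne
    refine ht.trans_le ?_
    calc (t : ℝ≥0∞) ≤ t + (hitTime b (shift t y) : ℝ≥0∞) := le_self_add
      _ = _ := add_hitTime_shift b y t
      _ ≤ _ := by
        refine add_le_add le_rfl (le_trans (le_of_eq ?_) (ENNReal.sum_le_tsum (Finset.range t)))
        refine Finset.sum_congr rfl fun s _ => ?_
        simp
  | coe t =>
    rw [tsum_eq_single t, if_pos rfl, tsum_eq_sum (s := Finset.range t), ENat.toENNReal_coe,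
      add_hitTime_shift b y t]
    · congr 1
      refine Finset.sum_congr rfl fun s hs => ?_
      have : ((s + 1 : ℕ) : ℕ∞) ≤ t := Nat.cast_le.2 (Finset.mem_range.1 hs)
      simp only [this, true_and]
    · intro s hs
      refine if_neg fun h => hs (Finset.mem_range.2 (Nat.cast_le.1 h.1))
    · intro s hs
      refine if_neg fun h => hs (Nat.cast_injective h).symm

/-- The entries of `y` right after time `n` are those of the pattern `(x 1, …, x m)`. -/
def PatternAt (x : ℕ → S) (m : ℕ) (y : ℕ → S) (n : ℕ) : Prop :=
  ∀ i ∈ Finset.Icc 1 m, y (n + i) = x i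

variable {x : ℕ → S} {m : ℕ}

/-- The restart rule makes t + m the earliest admissible time; what remains is the search for a
first occurrence after t. -/
theorem obsTime_succ {y : ℕ → S} {j t : ℕ} (h : obsTime x m y j = t) :
    obsTime x m y (j + 1) = ((t + m : ℕ) : ℕ∞) + firstTime (fun n => PatternAt x m y (t + n)) := by
  have := firstTime_eq_add (t := t + m) (p := fun n => obsTime x m y j + (m : ℕ∞) ≤ (n : ℕ∞) ∧
      ∀ i ∈ Finset.Icc 1 m, y (n - m + i) = x i) fun n hn => by
    have := hn.1
    rw [h] at this
    exact_mod_cast this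
  refine this.trans (congrArg _ (congrArg firstTime (funext fun n => propext ?_)))
  have e : t + m + n - m = t + n := by omega
  rw [e, h]
  refine ⟨fun hn => hn.2, fun hn => ⟨?_, hn⟩⟩
  exact_mod_cast (by omega : t + m ≤ t + m + n)

theorem obsTime_one (y : ℕ → S) : obsTime x m y 1 = (m : ℕ∞) + firstTime (PatternAt x m y) := by
  have := obsTime_succ (x := x) (m := m) (y := y) (j := 0) (t := 0) rfl
  simpa using this

theorem obsTime_one_eq_coe_iff {y : ℕ → S} {n : ℕ} :
    obsTime x m y 1 = ((n + m : ℕ) : ℕ∞) ↔ PatternAt x m y n ∧ ∀ k < n, ¬PatternAt x m y k := by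
  rw [obsTime_one, Nat.cast_add, add_comm, ← firstTime_eq_coe_iff]
  exact ENat.add_left_injective_of_ne_top (ENat.natCast_ne_top m) |>.eq_iff

theorem le_obsTime_one_iff {y : ℕ → S} {n : ℕ} :
    (n : ℕ∞) ≤ obsTime x m y 1 ↔ ∀ k, PatternAt x m y k → n ≤ k + m := by
  rw [obsTime_one]
  constructor
  · intro h k hk
    have := h.trans (add_le_add_right (firstTime_le hk) (m : ℕ∞))
    rw [add_comm]
    exact_mod_cast this
  · intro h
    generalize hu : firstTime (PatternAt x m y) = u
    induction u using ENat.recTopCoe with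
    | top => simp
    | coe u =>
      have := h u (firstTime_eq_coe_iff.1 hu).1
      rw [add_comm]
      exact_mod_cast this

theorem obsTime_ne_top_of_succ {y : ℕ → S} {j t : ℕ} (h : obsTime x m y (j + 1) = t) :
    ∃ s : ℕ, obsTime x m y j = s := by
  have h1 := (firstTime_eq_coe_iff (p := fun n => obsTime x m y j + (m : ℕ∞) ≤ (n : ℕ∞) ∧
      ∀ i ∈ Finset.Icc 1 m, y (n - m + i) = x i)).1 h
  refine ENat.ne_top_iff_exists.1 (fun htop => ?_) |>.imp fun _ => Eq.symm
  have := h1.1.1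
  rw [htop, top_add] at this
  exact ENat.natCast_ne_top t (top_le_iff.1 this)

theorem obsTime_succ_eq_add {y : ℕ → S} {j t : ℕ} (h : obsTime x m y j = t) :
    obsTime x m y (j + 1) = t + obsTime x m (shift t y) 1 := by
  rw [obsTime_succ h, obsTime_one, Nat.cast_add, add_assoc]
  refine congrArg _ (congrArg _ (congrArg firstTime (funext fun n => propext ?_)))
  exact forall₂_congr fun i _ => by rw [shift, add_assoc]

theorem waitTime_eq {y : ℕ → S} {j t : ℕ} (h : obsTime x m y j = t) :
    waitTime x m y j = obsTime x m (shift t y) 1 := by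
  rw [waitTime, obsTime_succ_eq_add h, h]
  exact ENat.addLECancellable_natCast t |>.add_tsub_cancel_left

/-- Observation times are stopping times: a finite value t forces the previous observation to be
finite and earlier, and the search from there looks only at entries up to t. -/
theorem knownAt_obsTime (x : ℕ → S) (m j t : ℕ) : KnownAt t {y : ℕ → S | obsTime x m y j = t} := by
  induction j generalizing t with
  | zero => exact knownAt_of_forall fun y z _ hy => hy
  | succ j ih =>
    refine knownAt_of_forall fun y z hyz (hy : obsTime x m y (j + 1) = t) => ?_
    obtain ⟨s, hs⟩ := obsTime_ne_top_of_succ hy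
    have hst := hy
    rw [obsTime_succ hs] at hst
    generalize hu : firstTime (fun n => PatternAt x m y (s + n)) = u at hst
    induction u using ENat.recTopCoe with
    | top => rw [add_top] at hst; exact absurd hst.symm (ENat.natCast_ne_top t)
    | coe u =>
      have hsu : s + m + u = t := by exact_mod_cast hst
      have hsz : obsTime x m z j = s := by
        have : (obsTime x m y j = s) = (obsTime x m z j = s) :=
          ih s fun i hi => hyz i (le_trans hi (by omega))
        exact this ▸ hs
      have hpat : ∀ k ≤ u, PatternAt x m y (s + k) ↔ PatternAt x m z (s + k) := fun k hk =>
        forall₂_congr fun i hi => by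
          rw [hyz _ (by have := (Finset.mem_Icc.1 hi).2; omega)]
      have hu' := firstTime_eq_coe_iff.1 hu
      have : firstTime (fun n => PatternAt x m z (s + n)) = u := firstTime_eq_coe_iff.2
        ⟨(hpat u le_rfl).1 hu'.1, fun k hk hp => hu'.2 k hk ((hpat k hk.le).2 hp)⟩
      change obsTime x m z (j + 1) = t
      rw [obsTime_succ hsz, this, ← hsu]
      norm_cast

/-- An occurrence never uses the entry at time 0. This permits an artificial initial state in the
iid case. -/
theorem obsTime_congr {y z : ℕ → S} (h : ∀ i, 1 ≤ i → y i = z i) (j : ℕ) :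
    obsTime x m y j = obsTime x m z j := by
  induction j with
  | zero => rfl
  | succ j ih =>
    simp only [obsTime, ih]
    congr 1
    ext t
    refine exists_congr fun n => and_congr_right fun _ => and_congr_right fun _ => ?_
    exact forall₂_congr fun i hi => by
      rw [h _ (by have := (Finset.mem_Icc.1 hi).1; omega)]

theorem obsTime_succ_state (hm : 1 ≤ m) {y : ℕ → S} {j t : ℕ} (h : obsTime x m y (j + 1) = t) :
    y t = x m := by
  have h1 := (firstTime_eq_coe_iff (p := fun n => obsTime x m y j + (m : ℕ∞) ≤ (n : ℕ∞) ∧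
      ∀ i ∈ Finset.Icc 1 m, y (n - m + i) = x i)).1 h
  have h2 : (m : ℕ∞) ≤ t := le_trans le_add_self h1.1.1
  have h3 := h1.1.2 m (Finset.mem_Icc.2 ⟨hm, le_rfl⟩)
  rwa [Nat.sub_add_cancel (Nat.cast_le.1 h2)] at h3

/-- The v + m - n common letters are the tail of the earlier occurrence and the head of the later
one. -/
theorem overlap_of_patternAt {y : ℕ → S} {n v : ℕ} (hvn : v ≤ n) (hn : n < v + m)
    (hv : PatternAt x m y v) (h : PatternAt x m y n) :
    ∀ i ∈ Finset.Icc 1 (v + m - n), x i = x (m - (v + m - n) + i) := by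
  intro i hi
  have hi' := Finset.mem_Icc.1 hi
  rw [← h i (Finset.mem_Icc.2 (by omega)), ← hv _ (Finset.mem_Icc.2 (by omega))]
  congr 1
  omega

/-- An occurrence starting at time n + 1 ≤ T, if not the first, would share at least one letter with
an earlier one and produce an overlap. -/
theorem noOverlap_iff_obsTime (hx : NoOverlap x m) (hm : 1 ≤ m) (y : ℕ → S) (n : ℕ) :
    (((n + 1 : ℕ) : ℕ∞) ≤ obsTime x m y 1 ∧ PatternAt x m y n) ↔
      obsTime x m y 1 = ((n + m : ℕ) : ℕ∞) := by
  rw [obsTime_one_eq_coe_iff, le_obsTime_one_iff]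
  constructor
  · rintro ⟨h1, h2⟩
    refine ⟨h2, fun v hvn hv => ?_⟩
    have h3 := h1 v hv
    have := hx.2 (show v + m - n ∈ _ from
      ⟨by omega, overlap_of_patternAt hvn.le (by omega) hv h2⟩)
    omega
  · rintro ⟨h1, h2⟩
    refine ⟨fun k hk => ?_, h1⟩
    by_contra hlt
    exact h2 k (by omega) hk

/-- A second occurrence starting by time T must share exactly k letters with the first: maximality
excludes more, and the absence of overlap in the prefix excludes fewer. -/
theorem overlap_iff_obsTime {k : ℕ} (hk : 1 ≤ k) (hx : HasOverlapOfSize x m k) (hxk : NoOverlap x k)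
    (y : ℕ → S) (n : ℕ) :
    (((n + 1 : ℕ) : ℕ∞) ≤ obsTime x m y 1 ∧ PatternAt x m y n) ↔
      (obsTime x m y 1 = ((n + m : ℕ) : ℕ∞) ∨ (obsTime x m y 1 = ((n + k : ℕ) : ℕ∞) ∧
        ∀ i ∈ Finset.Icc 1 (m - k), y (n + k + i) = x (k + i))) := by
  classical
  have hkm : k < m := hx.1.1
  constructor
  · rintro ⟨h1, h2⟩
    rw [le_obsTime_one_iff] at h1
    by_cases hex : ∃ v, v < n ∧ PatternAt x m y v
    · right
      have hv := Nat.find_spec hex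
      have hmin := fun w (hw : w < Nat.find hex) => Nat.find_min hex hw
      set v := Nat.find hex
      have h3 := h1 v hv.2
      have hov := overlap_of_patternAt hv.1.le (by omega) hv.2 h2
      have hle : v + m - n ≤ k := hx.2 ⟨by omega, hov⟩
      have heq : v + m - n = k := by
        by_contra hne
        -- A nonempty overlap shorter than k, carried from the last k letters to the first k, would
        -- be an overlap of the prefix.
        have : v + m - n ≤ 0 := hxk.2 ⟨by omega, fun i hi => by
          have hi' := Finset.mem_Icc.1 hi
          rw [hov i hi, hx.1.2 (k - (v + m - n) + i) (Finset.mem_Icc.2 (by omega))]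
          congr 1
          omega⟩
        omega
      constructor
      · have : n + k = v + m := by omega
        rw [this, obsTime_one_eq_coe_iff]
        exact ⟨hv.2, fun w hw hp => hmin w hw ⟨by omega, hp⟩⟩
      · intro i hi
        have hi' := Finset.mem_Icc.1 hi
        rw [add_assoc]
        exact h2 (k + i) (Finset.mem_Icc.2 (by omega))
    · left
      rw [obsTime_one_eq_coe_iff]
      exact ⟨h2, fun v hv hp => hex ⟨v, hv, hp⟩⟩
  · rintro (h | ⟨h1, h2⟩)
    · refine ⟨?_, (obsTime_one_eq_coe_iff.1 h).1⟩
      rw [h]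
      exact Nat.cast_le.2 (by omega)
    · refine ⟨?_, ?_⟩
      · rw [h1]
        exact Nat.cast_le.2 (by omega)
      · have hmn : m ≤ n + k := by
          have : (m : ℕ∞) ≤ obsTime x m y 1 := by rw [obsTime_one]; exact le_self_add
          rw [h1] at this
          exact Nat.cast_le.1 this
        have hv : PatternAt x m y (n + k - m) := by
          have : n + k = (n + k - m) + m := by omega
          rw [this, obsTime_one_eq_coe_iff] at h1
          exact h1.1
        intro i hi
        have hi' := Finset.mem_Icc.1 hi
        by_cases hik : i ≤ k
        · rw [hx.1.2 i (Finset.mem_Icc.2 (by omega)), ← hv _ (Finset.mem_Icc.2 (by omega))]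
          congr 1
          omega
        · have := h2 (i - k) (Finset.mem_Icc.2 (by omega))
          have e1 : n + k + (i - k) = n + i := by omega
          have e2 : k + (i - k) = i := by omega
          rwa [e1, e2] at this

end Paths

/-! ### Measurability of hitting and observation times -/

section Measurability

variable {S : Type*} [Countable S] [MeasurableSpace S] [MeasurableSingletonClass S]

theorem measurable_of_measurableSet_eq_coe {α : Type*} [MeasurableSpace α] {T : α → ℕ∞}
    (h : ∀ n : ℕ, MeasurableSet {y | T y = n}) : Measurable T := by
  refine measurable_to_countable' fun t => ?_
  induction t using ENat.recTopCoe with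
  | coe n => exact h n
  | top =>
    have : T ⁻¹' {⊤} = (⋃ n : ℕ, {y | T y = n})ᶜ := by
      ext y
      simp only [Set.mem_preimage, Set.mem_singleton_iff, Set.mem_compl_iff, Set.mem_iUnion,
        not_exists]
      constructor
      · intro h n hn
        exact ENat.natCast_ne_top n ((Eq.symm hn).trans h)
      · intro h
        by_contra hne
        obtain ⟨n, hn⟩ := ENat.ne_top_iff_exists.1 hne
        exact h n hn.symm
    rw [this]
    exact (MeasurableSet.iUnion h).compl

theorem measurable_hitTime (b : S) : Measurable (fun y : ℕ → S => hitTime b y) :=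
  measurable_of_measurableSet_eq_coe fun n => (knownAt_hitTime b n).measurableSet

theorem measurable_obsTime (x : ℕ → S) (m j : ℕ) :
    Measurable (fun y : ℕ → S => obsTime x m y j) :=
  measurable_of_measurableSet_eq_coe fun n => (knownAt_obsTime x m j n).measurableSet

theorem measurable_toENNReal : Measurable (fun t : ℕ∞ => (t : ℝ≥0∞)) := Measurable.of_discrete

end Measurability

/-! ### Mean return times and Kac's formula -/

section Kac

theorem lintegral_eq_tsum_fiber {α β : Type*} [MeasurableSpace α] [Countable β]
    {ν : Measure α} {g : α → β} (hg : ∀ c, MeasurableSet {y | g y = c}) (f : α → ℝ≥0∞) :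
    ∫⁻ y, f y ∂ν = ∑' c, ∫⁻ y in {y | g y = c}, f y ∂ν := by
  rw [← lintegral_iUnion hg, ← setLIntegral_univ]
  · congr 2
    ext y
    simp
  · intro c d hcd
    refine Set.disjoint_left.2 fun y (hc : g y = c) (hd : g y = d) => hcd (hc.symm.trans hd)

theorem measure_eq_tsum_fiber {α β : Type*} [MeasurableSpace α] [Countable β]
    {ν : Measure α} {g : α → β} (hg : ∀ c, MeasurableSet {y | g y = c}) (A : Set α) :
    ν A = ∑' c, ν (A ∩ {y | g y = c}) := by
  have := lintegral_eq_tsum_fiber (ν := ν.restrict A) hg 1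
  simp only [lintegral_one, Pi.one_apply, Measure.restrict_apply (hg _),
    Measure.restrict_apply_univ] at this
  rw [this]
  exact tsum_congr fun c => by rw [Set.inter_comm]

theorem tsum_lt_eq_toENNReal (T : ℕ∞) :
    ∑' n : ℕ, (if (n : ℕ∞) < T then 1 else 0 : ℝ≥0∞) = T := by
  induction T using ENat.recTopCoe with
  | top => simp
  | coe t =>
    rw [tsum_eq_sum (s := Finset.range t)]
    · rw [Finset.sum_congr rfl fun n hn => if_pos (Nat.cast_lt.2 (Finset.mem_range.1 hn))]
      simp
    · intro n hn
      exact if_neg fun h => hn (Finset.mem_range.2 (Nat.cast_lt.1 h))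

theorem lintegral_toENNReal {α : Type*} [MeasurableSpace α] (ν : Measure α) {T : α → ℕ∞}
    (hT : Measurable T) : ∫⁻ y, (T y : ℝ≥0∞) ∂ν = ∑' n : ℕ, ν {y | (n : ℕ∞) < T y} := by
  have hm : ∀ n : ℕ, MeasurableSet {y | (n : ℕ∞) < T y} := fun n =>
    hT (Set.to_countable {t | (n : ℕ∞) < t}).measurableSet
  calc ∫⁻ y, (T y : ℝ≥0∞) ∂ν
      = ∫⁻ y, ∑' n : ℕ, {y | (n : ℕ∞) < T y}.indicator (fun _ => 1) y ∂ν := by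
        refine lintegral_congr fun y => ?_
        rw [← tsum_lt_eq_toENNReal]
        exact tsum_congr fun n => by simp [Set.indicator_apply]
    _ = _ := by
        rw [lintegral_tsum fun n => (measurable_const.indicator (hm n)).aemeasurable]
        exact tsum_congr fun n => by rw [lintegral_indicator_const (hm n), one_mul]

theorem knownAt_lt_hitTime {S : Type*} (b : S) (n : ℕ) : KnownAt n {y : ℕ → S | (n : ℕ∞) < hitTime b y} := by
  refine knownAt_of_forall fun y z hyz hy => ?_
  refine lt_hitTime_iff.2 fun i h1 h2 h3 => ?_
  exact lt_hitTime_iff.1 hy i h1 h2 ((hyz i h2).trans h3)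

variable {S : Type*} [Countable S] [MeasurableSpace S] [MeasurableSingletonClass S]

theorem chainLaw_start_eq_one (P : S → PMF S) (a : S) : chainLaw P a {y | y 0 = a} = 1 :=
  (prob_compl_eq_zero_iff (knownAt_state (n := 0) le_rfl a).measurableSet).1 (chainLaw_start P a)

theorem chainLaw_next (P : S → PMF S) (a c : S) : chainLaw P a {y | y 1 = c} = P a c := by
  have h := (chainLaw_isMarkovLaw P a).measure_inter_next (knownAt_state (n := 0) le_rfl a)
    (fun _ hy => hy) c
  rw [chainLaw_start_eq_one, one_mul] at h
  rw [← h]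
  refine measure_congr ?_
  filter_upwards [chainLaw_start P a] with y hy
  exact propext ⟨fun h => ⟨hy, h⟩, fun h => h.2⟩

/-- First step analysis for the mean hitting time. -/
theorem meanHitTime_eq [DecidableEq S] (P : S → PMF S) (a b : S) :
    meanHitTime P a b = 1 + ∑' c, if c = b then 0 else P a c * meanHitTime P c b := by
  have hK : ∀ c : S, KnownAt 1 {y : ℕ → S | y 1 = c} := fun c => knownAt_state le_rfl c
  have mH : Measurable fun y : ℕ → S => (hitTime b y : ℝ≥0∞) :=
    measurable_toENNReal.comp (measurable_hitTime b)
  have h1 : ∀ y : ℕ → S, (hitTime b y : ℝ≥0∞) =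
      1 + if y 1 = b then 0 else (hitTime b (shift 1 y) : ℝ≥0∞) := fun y => by
    by_cases h : y 1 = b
    · simp [hitTime_of_eq h, h]
    · simp [hitTime_of_ne h, h]
  conv_lhs => rw [meanHitTime, lintegral_congr h1, lintegral_add_left measurable_const]
  rw [lintegral_one, measure_univ, lintegral_eq_tsum_fiber fun c => (hK c).measurableSet]
  congr 1
  refine tsum_congr fun c => ?_
  split_ifs with hc
  · subst hc
    rw [setLIntegral_congr_fun (hK c).measurableSet (g := fun _ => 0)]
    · simp
    · intro y (hy : y 1 = c)
      simp [hy]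
  · rw [setLIntegral_congr_fun (hK c).measurableSet (g := fun y => (hitTime b (shift 1 y) : ℝ≥0∞)),
      (chainLaw_isMarkovLaw P a).setLIntegral_shift (hK c) (fun y hy => hy) mH, chainLaw_next]
    · rfl
    · intro y (hy : y 1 = c)
      simp [hy, hc]

/-- An infinite mean at c, reached with positive probability, would make the mean at a infinite. The
first-step formula omits c = b, hence the separate hypothesis on b. -/
theorem meanHitTime_ne_top_of_step {P : S → PMF S} {a b c : S} (h : meanHitTime P a b ≠ ∞)
    (hb : meanHitTime P b b ≠ ∞) (hac : P a c ≠ 0) : meanHitTime P c b ≠ ∞ := by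
  classical
  by_cases hc : c = b
  · rwa [hc]
  · intro htop
    refine h ?_
    rw [meanHitTime_eq, eq_top_iff]
    refine le_trans ?_ le_add_self
    refine le_trans ?_ (ENNReal.le_tsum c)
    rw [if_neg hc, htop, ENNReal.mul_top hac]

/-- The mean number of visits to `c` during an excursion from `b`. -/
noncomputable def excursionMass (P : S → PMF S) (b c : S) : ℝ≥0∞ :=
  ∑' n : ℕ, chainLaw P b ({y | (n : ℕ∞) < hitTime b y} ∩ {y | y n = c})

theorem tsum_excursionMass (P : S → PMF S) (b : S) :
    ∑' c, excursionMass P b c = meanHitTime P b b := by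
  rw [meanHitTime, lintegral_toENNReal _ (measurable_hitTime b)]
  simp only [excursionMass]
  rw [ENNReal.tsum_comm]
  refine tsum_congr fun n => ?_
  exact (measure_eq_tsum_fiber (fun c => (knownAt_state le_rfl c).measurableSet) _).symm

theorem excursion_zero [DecidableEq S] (P : S → PMF S) (b c : S) :
    chainLaw P b ({y | ((0 : ℕ) : ℕ∞) < hitTime b y} ∩ {y | y 0 = c}) = if c = b then 1 else 0 := by
  have : {y : ℕ → S | ((0 : ℕ) : ℕ∞) < hitTime b y} ∩ {y | y 0 = c} = {y | y 0 = c} :=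
    Set.inter_eq_right.2 fun y _ => lt_hitTime_iff.2 fun i h1 h2 => by omega
  rw [this]
  split_ifs with h
  · rw [h, chainLaw_start_eq_one]
  · refine measure_mono_null ?_ (chainLaw_start P b)
    intro y hy hb
    exact h ((Eq.symm hy).trans hb)

theorem excursion_succ [DecidableEq S] (P : S → PMF S) (b c : S) (n : ℕ) :
    chainLaw P b ({y | ((n + 1 : ℕ) : ℕ∞) < hitTime b y} ∩ {y | y (n + 1) = c}) =
      if c = b then 0 else
        ∑' a, chainLaw P b ({y | (n : ℕ∞) < hitTime b y} ∩ {y | y n = a}) * P a c := by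
  split_ifs with h
  · convert measure_empty (μ := chainLaw P b)
    refine Set.eq_empty_of_forall_notMem ?_
    rintro y ⟨h1, h2⟩
    exact lt_hitTime_iff.1 h1 (n + 1) (by omega) le_rfl (h ▸ h2)
  · have e : {y : ℕ → S | ((n + 1 : ℕ) : ℕ∞) < hitTime b y} ∩ {y | y (n + 1) = c} =
        {y | (n : ℕ∞) < hitTime b y} ∩ {y | y (n + 1) = c} := by
      ext y
      refine and_congr_left fun (hy : y (n + 1) = c) => ?_
      change ((n + 1 : ℕ) : ℕ∞) < hitTime b y ↔ (n : ℕ∞) < hitTime b y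
      rw [lt_hitTime_iff, lt_hitTime_iff]
      refine ⟨fun h i h1 h2 => h i h1 (by omega), fun h' i h1 h2 => ?_⟩
      rcases Nat.le_succ_iff.1 h2 with h3 | h3
      · exact h' i h1 h3
      · subst h3
        rwa [hy]
    rw [e, measure_eq_tsum_fiber (g := fun y => y n)
      (fun c => (knownAt_state le_rfl c).measurableSet)]
    refine tsum_congr fun a => ?_
    rw [← (chainLaw_isMarkovLaw P b).measure_inter_next
      ((knownAt_lt_hitTime b n).inter (knownAt_state le_rfl a)) fun y hy => hy.2]
    rw [Set.inter_right_comm]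

/-- Away from b, every time of an excursion is one step after another time of it; at b only time 0
counts. So the mass is invariant off b. -/
theorem excursionMass_eq [DecidableEq S] (P : S → PMF S) (b c : S) :
    excursionMass P b c = if c = b then 1 else ∑' a, excursionMass P b a * P a c := by
  rw [excursionMass, tsum_eq_zero_add' ENNReal.summable, excursion_zero]
  simp only [excursion_succ]
  split_ifs with h
  · simp
  · rw [zero_add, ENNReal.tsum_comm]
    refine tsum_congr fun a => ?_
    rw [ENNReal.tsum_mul_right]
    rfl

/-- Iterating π = πP and cutting at visits to b bounds the truncated sums by induction. No
recurrence is presupposed; finiteness of the mean return time is a consequence. -/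
theorem mul_excursionMass_le {P : S → PMF S} {π : PMF S} (hπ : π.bind P = π) (b c : S) :
    π b * excursionMass P b c ≤ π c := by
  classical
  have key : ∀ N : ℕ, ∀ c, π b * ∑ n ∈ Finset.range (N + 1),
      chainLaw P b ({y | (n : ℕ∞) < hitTime b y} ∩ {y | y n = c}) ≤ π c := by
    intro N
    induction N with
    | zero =>
      intro c
      rw [zero_add, Finset.sum_range_one, excursion_zero]
      split_ifs with h
      · simp [h]
      · simp
    | succ N ih =>
      intro c
      rw [Finset.sum_range_succ', excursion_zero]
      simp only [excursion_succ]
      split_ifs with h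
      · simp [h]
      · rw [add_zero, ← Summable.tsum_finsetSum fun _ _ => ENNReal.summable]
        have hc : π c = ∑' a, π a * P a c := by
          conv_lhs => rw [← hπ, PMF.bind_apply]
        rw [hc, ← ENNReal.tsum_mul_left]
        refine ENNReal.tsum_le_tsum fun a => ?_
        rw [← Finset.sum_mul, ← mul_assoc]
        exact mul_le_mul_left (ih a) _
  rw [excursionMass, ENNReal.tsum_eq_iSup_nat, ENNReal.mul_iSup]
  refine iSup_le fun N => le_trans (mul_le_mul_right ?_ _) (key N c)
  exact Finset.sum_le_sum_of_subset (Finset.range_mono (Nat.le_succ N))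

/-- Total mass one settles the remaining point, so invariance of the excursion mass need not be
checked at b itself. -/
theorem pmf_ext_of_ne {S : Type*} {p q : PMF S} (b : S) (h : ∀ c, c ≠ b → p c = q c) : p = q := by
  classical
  refine PMF.ext fun c => ?_
  by_cases hc : c = b
  · subst hc
    have hp := p.tsum_coe
    have hq := q.tsum_coe
    rw [ENNReal.tsum_eq_add_tsum_ite c] at hp hq
    have e : ∑' x, (if x = c then 0 else p x) = ∑' x, if x = c then 0 else q x := by
      refine tsum_congr fun x => ?_
      split_ifs with hx
      · rfl
      · exact h x hx
    rw [e] at hp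
    have htop : ∑' x, (if x = c then 0 else q x) ≠ ∞ := fun htop => by
      rw [htop, add_top] at hq
      exact ENNReal.top_ne_one hq
    exact (ENNReal.add_left_inj htop).1 (hp.trans hq.symm)
  · exact h c hc

/-- The mean return time to a state charged by the only stationary distribution. -/
theorem IsTheStationaryDistribution.meanHitTime_self {P : S → PMF S} {π : PMF S}
    (h : IsTheStationaryDistribution P π) {b : S} (hb : π b ≠ 0) :
    meanHitTime P b b = (π b)⁻¹ := by
  classical
  set M := meanHitTime P b b with hM
  have hle : π b * M ≤ 1 := by
    rw [hM, ← tsum_excursionMass, ← ENNReal.tsum_mul_left, ← π.tsum_coe]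
    exact ENNReal.tsum_le_tsum fun c => mul_excursionMass_le h.1 b c
  have hMtop : M ≠ ∞ := fun htop => by
    rw [htop, ENNReal.mul_top hb] at hle
    exact absurd hle (by simp)
  have hM0 : M ≠ 0 := by
    rw [hM, meanHitTime_eq]
    simp
  have hsum : ∑' c, M⁻¹ * excursionMass P b c = 1 := by
    rw [ENNReal.tsum_mul_left, tsum_excursionMass, ← hM, ENNReal.inv_mul_cancel hM0 hMtop]
  -- The normalized excursion mass is stationary, hence equals π; its value at b is M⁻¹.
  let ρ : PMF S := ⟨fun c => M⁻¹ * excursionMass P b c, hsum ▸ ENNReal.summable.hasSum⟩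
  have hρ : ∀ c, ρ c = M⁻¹ * excursionMass P b c := fun _ => rfl
  have hst : ρ.bind P = ρ := pmf_ext_of_ne b fun c hc => by
    rw [PMF.bind_apply, hρ c, excursionMass_eq, if_neg hc, ← ENNReal.tsum_mul_left]
    exact tsum_congr fun a => by rw [hρ, mul_assoc]
  have := hρ b
  rw [h.2 ρ hst, excursionMass_eq, if_pos rfl, mul_one] at this
  rw [this, inv_inv]

end Kac

/-! ### Wald's identity and the count of occurrences -/

section Counting

/-- The event is the complement of τ_j ≤ n, which is decided at time n. -/
theorem knownAt_le_obsTime {S : Type*} (x : ℕ → S) (m j n : ℕ) :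
    KnownAt n {y : ℕ → S | ((n + 1 : ℕ) : ℕ∞) ≤ obsTime x m y j} := by
  refine knownAt_of_forall fun y z hyz (hy : ((n + 1 : ℕ) : ℕ∞) ≤ obsTime x m y j) => ?_
  change ((n + 1 : ℕ) : ℕ∞) ≤ obsTime x m z j
  by_contra hlt
  obtain ⟨t, ht⟩ := ENat.ne_top_iff_exists.1 (ne_top_of_lt (not_le.1 hlt))
  rw [← ht, Nat.cast_le] at hlt
  have : (obsTime x m z j = t) = (obsTime x m y j = t) :=
    knownAt_obsTime x m j t fun i hi => (hyz i (le_trans hi (by omega))).symm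
  have h1 : obsTime x m y j = t := this ▸ ht.symm
  rw [h1, Nat.cast_le] at hy
  exact hlt hy

theorem knownAt_word {S : Type*} (x : ℕ → S) (n c r : ℕ) :
    KnownAt (n + r) {y : ℕ → S | ∀ i ∈ Finset.Icc 1 r, y (n + i) = x (c + i)} :=
  knownAt_of_forall fun y z hyz (hy : ∀ i ∈ Finset.Icc 1 r, y (n + i) = x (c + i)) i hi =>
    (hyz (n + i) (by have := (Finset.mem_Icc.1 hi).2; omega)).symm.trans (hy i hi)

theorem knownAt_visit {S : Type*} (x : ℕ → S) (m n : ℕ) :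
    KnownAt (n + 1) ({y : ℕ → S | ((n + 1 : ℕ) : ℕ∞) ≤ obsTime x m y 1} ∩ {y | y (n + 1) = x 1}) :=
  ((knownAt_le_obsTime x m 1 n).mono (Nat.le_succ n)).inter (knownAt_state le_rfl _)

variable {S : Type*} [Countable S] [MeasurableSpace S] [MeasurableSingletonClass S]
  {P : S → PMF S} {x : ℕ → S} {m : ℕ}

theorem IsMarkovLaw.measure_inter_word {ν : Measure (ℕ → S)} (hν : IsMarkovLaw P ν) {n c : ℕ}
    {A : Set (ℕ → S)} (hA : KnownAt n A) (ha : ∀ y ∈ A, y n = x c) (r : ℕ) :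
    ν (A ∩ {y | ∀ i ∈ Finset.Icc 1 r, y (n + i) = x (c + i)}) =
      ν A * ∏ i ∈ Finset.Ico c (c + r), P (x i) (x (i + 1)) := by
  induction r with
  | zero => simp
  | succ r ih =>
    rw [← add_assoc c r 1, Finset.prod_Ico_succ_top (by omega), ← mul_assoc, ← ih,
      ← hν.measure_inter_next ((hA.mono (by omega)).inter (knownAt_word x n c r)) ?_]
    · congr 1
      ext y
      constructor
      · rintro ⟨h1, h2⟩
        refine ⟨⟨h1, fun i hi => ?_⟩, h2 (r + 1) (by simp)⟩
        have := Finset.mem_Icc.1 hi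
        exact h2 i (Finset.mem_Icc.2 (by omega))
      · rintro ⟨⟨h1, h2⟩, h3⟩
        refine ⟨h1, fun i hi => ?_⟩
        have hi' := Finset.mem_Icc.1 hi
        rcases Nat.le_succ_iff.1 hi'.2 with h | h
        · exact h2 i (Finset.mem_Icc.2 ⟨hi'.1, h⟩)
        · subst h; exact h3
    · rintro y ⟨h1, h2⟩
      rcases Nat.eq_zero_or_pos r with rfl | hr
      · exact ha y h1
      · exact h2 r (Finset.mem_Icc.2 ⟨hr, le_rfl⟩)

/-- The mean number of visits to the first letter of the pattern until the first observation. -/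
noncomputable def meanVisits (P : S → PMF S) (x : ℕ → S) (m : ℕ) (a : S) : ℝ≥0∞ :=
  ∑' n : ℕ, chainLaw P a ({y | ((n + 1 : ℕ) : ℕ∞) ≤ obsTime x m y 1} ∩ {y | y (n + 1) = x 1})

theorem measure_obsTime_ne_top (ν : Measure (ℕ → S)) (x : ℕ → S) (m j : ℕ) :
    ν {y | obsTime x m y j ≠ ⊤} = ∑' t : ℕ, ν {y | obsTime x m y j = t} := by
  rw [← measure_iUnion (fun s t hst => ?_) fun t => (knownAt_obsTime x m j t).measurableSet]
  · congr 1
    ext y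
    simp only [Set.mem_iUnion]
    exact ENat.ne_top_iff_exists.trans (exists_congr fun t => eq_comm)
  · refine Set.disjoint_left.2 fun y (h1 : _ = _) (h2 : _ = _) => hst ?_
    exact Nat.cast_injective (h1.symm.trans h2)

/-- Wald's identity: time from the start to the first visit to `x 1` after the first
observation, counted in two ways. -/
theorem lintegral_obsTime_add (P : S → PMF S) (x : ℕ → S) (hm : 1 ≤ m) (a : S) :
    ∫⁻ y, (obsTime x m y 1 : ℝ≥0∞) ∂chainLaw P a +
        chainLaw P a {y | obsTime x m y 1 ≠ ⊤} * meanHitTime P (x m) (x 1) =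
      meanHitTime P a (x 1) + meanVisits P x m a * meanHitTime P (x 1) (x 1) := by
  classical
  have mH : Measurable fun y : ℕ → S => (hitTime (x 1) y : ℝ≥0∞) :=
    measurable_toENNReal.comp (measurable_hitTime _)
  have mT : Measurable fun y : ℕ → S => (obsTime x m y 1 : ℝ≥0∞) :=
    measurable_toENNReal.comp (measurable_obsTime x m 1)
  -- The random times are split into deterministic ones, so the simple Markov property suffices for
  -- each summand.
  have key : ∀ (n : ℕ) (A : Set (ℕ → S)), KnownAt n A → ∀ c, (∀ y ∈ A, y n = c) →
      ∀ f : (ℕ → S) → ℝ≥0∞, (∀ y ∈ A, f y = hitTime (x 1) (shift n y)) → (∀ y, y ∉ A → f y = 0) →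
      AEMeasurable f (chainLaw P a) ∧
      ∫⁻ y, f y ∂chainLaw P a = chainLaw P a A * meanHitTime P c (x 1) := by
    intro n A hA c hc f hf hf'
    have e : f = A.indicator fun y => (hitTime (x 1) (shift n y) : ℝ≥0∞) := by
      funext y
      by_cases hy : y ∈ A
      · rw [Set.indicator_of_mem hy, hf y hy]
      · rw [Set.indicator_of_notMem hy, hf' y hy]
    rw [e, lintegral_indicator hA.measurableSet,
      (chainLaw_isMarkovLaw P a).setLIntegral_shift hA hc mH]
    exact ⟨((mH.comp (measurable_shift n)).indicator hA.measurableSet).aemeasurable, rfl⟩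
  have k1 := fun t : ℕ => key t _ (knownAt_obsTime x m 1 t) (x m) (fun y hy =>
    obsTime_succ_state hm hy)
    (fun y => if obsTime x m y 1 = t then (hitTime (x 1) (shift t y) : ℝ≥0∞) else 0)
    (fun _ hy => if_pos hy) fun _ hy => if_neg hy
  have k2 := fun n : ℕ => key (n + 1) _ (knownAt_visit x m n) (x 1) (fun y hy => hy.2)
    (fun y => if ((n + 1 : ℕ) : ℕ∞) ≤ obsTime x m y 1 ∧ y (n + 1) = x 1 then
      (hitTime (x 1) (shift (n + 1) y) : ℝ≥0∞) else 0)
    (fun _ hy => if_pos hy) fun _ hy => if_neg hy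
  have h := lintegral_congr (μ := chainLaw P a) fun y =>
    add_tsum_hitTime_shift (x 1) y (obsTime x m y 1)
  rw [lintegral_add_left mT, lintegral_add_left mH] at h
  refine Eq.trans ?_ (h.trans ?_)
  · congr 1
    refine Eq.trans ?_ (lintegral_tsum fun t => (k1 t).1).symm
    rw [measure_obsTime_ne_top, ← ENNReal.tsum_mul_right]
    exact tsum_congr fun t => (k1 t).2.symm
  · congr 1
    refine (lintegral_tsum fun t => (k2 t).1).trans ?_
    rw [meanVisits, ← ENNReal.tsum_mul_right]
    exact tsum_congr fun t => (k2 t).2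

theorem measure_visit_mul (P : S → PMF S) (x : ℕ → S) (hm : 1 ≤ m) (a : S) (n : ℕ) :
    chainLaw P a ({y | ((n + 1 : ℕ) : ℕ∞) ≤ obsTime x m y 1} ∩ {y | y (n + 1) = x 1}) *
        ∏ i ∈ Finset.Ico 1 m, P (x i) (x (i + 1)) =
      chainLaw P a {y | ((n + 1 : ℕ) : ℕ∞) ≤ obsTime x m y 1 ∧ PatternAt x m y n} := by
  have h := (chainLaw_isMarkovLaw P a).measure_inter_word (x := x) (c := 1) (knownAt_visit x m n)
    (fun y hy => hy.2) (m - 1)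
  rw [Nat.add_sub_cancel' hm] at h
  rw [← h]
  congr 1
  ext y
  constructor
  · rintro ⟨⟨h1, h2⟩, h3⟩
    refine ⟨h1, fun i hi => ?_⟩
    have hi' := Finset.mem_Icc.1 hi
    rcases Nat.lt_or_ge 1 i with h | h
    · have := h3 (i - 1) (Finset.mem_Icc.2 (by omega))
      have e1 : n + 1 + (i - 1) = n + i := by omega
      have e2 : 1 + (i - 1) = i := by omega
      rwa [e1, e2] at this
    · have : i = 1 := by omega
      subst this
      exact h2
  · rintro ⟨h1, h2⟩
    refine ⟨⟨h1, h2 1 (Finset.mem_Icc.2 ⟨le_rfl, hm⟩)⟩, fun i hi => ?_⟩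
    have hi' := Finset.mem_Icc.1 hi
    rw [add_assoc]
    exact h2 (1 + i) (Finset.mem_Icc.2 (by omega))

/-- An observation cannot occur before time m ≥ k, so shifting the index loses no mass. -/
theorem tsum_measure_obsTime_eq_add (ν : Measure (ℕ → S)) (x : ℕ → S) {k : ℕ} (hk : k ≤ m) :
    ∑' n : ℕ, ν {y | obsTime x m y 1 = ((n + k : ℕ) : ℕ∞)} = ν {y | obsTime x m y 1 ≠ ⊤} := by
  rw [measure_obsTime_ne_top, ← Summable.sum_add_tsum_nat_add' (k := k)
      (f := fun t : ℕ => ν {y | obsTime x m y 1 = t}) ENNReal.summable,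
    Finset.sum_eq_zero, zero_add]
  intro i hi
  convert measure_empty (μ := ν)
  refine Set.eq_empty_of_forall_notMem fun y (hy : obsTime x m y 1 = i) => ?_
  have : (m : ℕ∞) ≤ obsTime x m y 1 := by rw [obsTime_one]; exact le_self_add
  rw [hy, Nat.cast_le] at this
  have := Finset.mem_range.1 hi
  omega

theorem meanVisits_mul_of_noOverlap (P : S → PMF S) (hm : 1 ≤ m) (hx : NoOverlap x m) (a : S) :
    meanVisits P x m a * ∏ i ∈ Finset.Ico 1 m, P (x i) (x (i + 1)) =
      chainLaw P a {y | obsTime x m y 1 ≠ ⊤} := by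
  rw [meanVisits, ← ENNReal.tsum_mul_right, ← tsum_measure_obsTime_eq_add _ x le_rfl]
  refine tsum_congr fun n => ?_
  rw [measure_visit_mul P x hm]
  congr 1
  ext y
  exact noOverlap_iff_obsTime hx hm y n

theorem meanVisits_mul_of_overlap (P : S → PMF S) (hm : 1 ≤ m) {k : ℕ} (hk : 1 ≤ k)
    (hx : HasOverlapOfSize x m k) (hxk : NoOverlap x k) (a : S) :
    meanVisits P x m a * ∏ i ∈ Finset.Ico 1 m, P (x i) (x (i + 1)) =
      chainLaw P a {y | obsTime x m y 1 ≠ ⊤} *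
        (1 + ∏ i ∈ Finset.Ico k m, P (x i) (x (i + 1))) := by
  have hkm : k < m := hx.1.1
  rw [meanVisits, mul_add, mul_one]
  conv_rhs => congr; rw [← tsum_measure_obsTime_eq_add _ x le_rfl]
  conv_rhs => enter [2]; rw [← tsum_measure_obsTime_eq_add _ x hkm.le]
  rw [← ENNReal.tsum_mul_right]
  rw [← ENNReal.tsum_mul_right, ← ENNReal.tsum_add]
  refine tsum_congr fun n => ?_
  rw [measure_visit_mul P x hm]
  -- At an observation the chain is in x_m, which equals x_k by the overlap; the completing letters
  -- therefore have probability R.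
  have hw := (chainLaw_isMarkovLaw P a).measure_inter_word (x := x) (c := k)
    (knownAt_obsTime x m 1 (n + k))
    (fun y hy => by
      rw [obsTime_succ_state hm hy]
      have := hx.1.2 k (Finset.mem_Icc.2 ⟨hk, le_rfl⟩)
      rw [this, Nat.sub_add_cancel hkm.le]) (m - k)
  rw [Nat.add_sub_cancel' hkm.le] at hw
  rw [← hw, ← measure_union]
  · congr 1
    ext y
    exact overlap_iff_obsTime hk hx hxk y n
  · refine Set.disjoint_left.2 fun y (h1 : _ = _) h2 => ?_
    have h3 : ((n + m : ℕ) : ℕ∞) = ((n + k : ℕ) : ℕ∞) := h1.symm.trans h2.1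
    have := Nat.cast_injective h3
    omega
  · exact ((knownAt_obsTime x m 1 (n + k)).mono (by omega : n + k ≤ n + k + (m - k))).inter
      (knownAt_word x _ _ _) |>.measurableSet

end Counting

/-! ### Mean waiting times of the chain -/

section MeanWaitingTime

/-- All identities are kept additive in [0, ∞]; only a finite term is ever subtracted, so infinite
means are covered. -/
theorem ereal_coe_eq_sub {A B h : ℝ≥0∞} (hh : h ≠ ∞) (e : A + h = B) :
    (A : EReal) = (B : EReal) - (h : EReal) := by
  lift h to NNReal using hh
  rw [← e, EReal.coe_ennreal_add]
  exact EReal.add_sub_cancel_right.symm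

theorem prod_transition_ne_top {S : Type*} (P : S → PMF S) (x : ℕ → S) (s : Finset ℕ) :
    ∏ i ∈ s, P (x i) (x (i + 1)) ≠ ∞ :=
  ENNReal.prod_ne_top fun _ _ => PMF.apply_ne_top _ _

theorem observedInState_eq_iUnion {S : Type*} (x : ℕ → S) (m j : ℕ) (a : S) :
    {y : ℕ → S | ObservedInState x m y j a} =
      ⋃ t : ℕ, {y | obsTime x m y j = t} ∩ {y | y t = a} := by
  ext y
  simp [ObservedInState]

theorem knownAt_observed {S : Type*} (x : ℕ → S) (m j : ℕ) (a : S) (t : ℕ) :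
    KnownAt t ({y : ℕ → S | obsTime x m y j = t} ∩ {y | y t = a}) :=
  (knownAt_obsTime x m j t).inter (knownAt_state le_rfl a)

theorem isTheStationaryDistribution_const {S : Type*} (p : PMF S) :
    IsTheStationaryDistribution (fun _ : S => p) p :=
  ⟨PMF.bind_const p p, fun ρ h => h.symm.trans (PMF.bind_const ρ p)⟩

theorem prod_Icc_eq_mul {S : Type*} (p : S → ℝ≥0∞) (x : ℕ → S) {r : ℕ} (hr : 1 ≤ r) :
    ∏ i ∈ Finset.Icc 1 r, p (x i) = p (x 1) * ∏ i ∈ Finset.Ico 1 r, p (x (i + 1)) := by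
  induction r, hr using Nat.le_induction with
  | base => simp
  | succ n hn ih =>
    rw [Finset.prod_Ico_succ_top hn, ← mul_assoc, ← ih, Finset.prod_Icc_succ_top (by omega)]

theorem waitTime_congr {S : Type*} {x : ℕ → S} {m : ℕ} {y z : ℕ → S} (h : ∀ i, 1 ≤ i → y i = z i) (j : ℕ) :
    waitTime x m y j = waitTime x m z j := by
  rw [waitTime, waitTime, obsTime_congr h, obsTime_congr h]

variable {S : Type*} [Countable S] [MeasurableSpace S] [MeasurableSingletonClass S]
  {P : S → PMF S} {π : PMF S} {x : ℕ → S} {m : ℕ}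

theorem IsTheStationaryDistribution.meanHitTime_pattern_ne_top
    (hπ : IsTheStationaryDistribution P π) (hm : 1 ≤ m) (h1 : π (x 1) ≠ 0)
    (hK : ∏ i ∈ Finset.Ico 1 m, P (x i) (x (i + 1)) ≠ 0) :
    meanHitTime P (x m) (x 1) ≠ ∞ := by
  have h11 : meanHitTime P (x 1) (x 1) ≠ ∞ := by
    rw [hπ.meanHitTime_self h1]
    exact ENNReal.inv_ne_top.2 h1
  induction m, hm using Nat.le_induction with
  | base => exact h11
  | succ n hn ih =>
    rw [Finset.prod_Ico_succ_top hn] at hK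
    exact meanHitTime_ne_top_of_step (ih (left_ne_zero_of_mul hK)) h11 (right_ne_zero_of_mul hK)

/-- The mean time of the first observation, in terms of the factor `c` by which the mean number of
visits to the first letter exceeds the value expected for a pattern without overlap. -/
theorem lintegral_obsTime_one (hπ : IsTheStationaryDistribution P π) (hm : 1 ≤ m)
    (h1 : π (x 1) ≠ 0) (hK : ∏ i ∈ Finset.Ico 1 m, P (x i) (x (i + 1)) ≠ 0) {c : ℝ≥0∞}
    (hc : c ≠ ∞) (a : S)
    (hN : meanVisits P x m a * ∏ i ∈ Finset.Ico 1 m, P (x i) (x (i + 1)) =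
      chainLaw P a {y | obsTime x m y 1 ≠ ⊤} * c) :
    ∫⁻ y, (obsTime x m y 1 : ℝ≥0∞) ∂chainLaw P a + meanHitTime P (x m) (x 1) =
      c * (∏ i ∈ Finset.Ico 1 m, P (x i) (x (i + 1)))⁻¹ * (π (x 1))⁻¹ + meanHitTime P a (x 1) := by
  have hW := lintegral_obsTime_add P x hm a
  have hxm := hπ.meanHitTime_pattern_ne_top hm h1 hK
  rw [hπ.meanHitTime_self h1] at hW
  set K := ∏ i ∈ Finset.Ico 1 m, P (x i) (x (i + 1)) with hKdef
  have hKt : K ≠ ∞ := prod_transition_ne_top P x _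
  set q := chainLaw P a {y | obsTime x m y 1 ≠ ⊤} with hq
  have hqt : q ≠ ∞ := measure_ne_top _ _
  have hV : meanVisits P x m a = q * c * K⁻¹ := by
    rw [← hN, mul_assoc, ENNReal.mul_inv_cancel hK hKt, mul_one]
  -- In the infinite case Wald's identity forces E T = ∞, since the other term on its left is
  -- finite.
  by_cases ha : meanHitTime P a (x 1) = ∞
  · rw [ha, top_add] at hW
    rcases ENNReal.add_eq_top.1 hW with h | h
    · rw [h, ha, top_add, add_top]
    · exact absurd h (ENNReal.mul_ne_top hqt hxm)
  · have hVt : meanVisits P x m a * (π (x 1))⁻¹ ≠ ∞ := by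
      rw [hV]
      exact ENNReal.mul_ne_top (ENNReal.mul_ne_top (ENNReal.mul_ne_top hqt hc)
        (ENNReal.inv_ne_top.2 hK)) (ENNReal.inv_ne_top.2 h1)
    -- Both terms on the right of Wald's identity are finite, so E T is finite and T is almost
    -- surely finite.
    have hT : ∫⁻ y, (obsTime x m y 1 : ℝ≥0∞) ∂chainLaw P a ≠ ∞ :=
      ne_top_of_le_ne_top (ENNReal.add_ne_top.2 ⟨ha, hVt⟩) (le_self_add.trans hW.le)
    have hae := ae_lt_top (measurable_toENNReal.comp (measurable_obsTime x m 1)) hT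
    have hq1 : q = 1 := by
      rw [hq]
      refine (prob_compl_eq_zero_iff ?_).1 ?_
      · exact (measurable_obsTime x m 1) (Set.to_countable {⊤}ᶜ).measurableSet
      · filter_upwards [hae] with y hy htop
        rw [Function.comp_apply, htop] at hy
        exact lt_irrefl _ hy
    rw [hV, hq1, one_mul, one_mul] at hW
    rw [hW, add_comm]

theorem lintegral_obsTime_one_of_noOverlap (hπ : IsTheStationaryDistribution P π) (hm : 1 ≤ m)
    (h0 : π (x 1) * ∏ i ∈ Finset.Ico 1 m, P (x i) (x (i + 1)) ≠ 0) (hx : NoOverlap x m) (a : S) :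
    ∫⁻ y, (obsTime x m y 1 : ℝ≥0∞) ∂chainLaw P a + meanHitTime P (x m) (x 1) =
      1 / (π (x 1) * ∏ i ∈ Finset.Ico 1 m, P (x i) (x (i + 1))) + meanHitTime P a (x 1) := by
  rw [lintegral_obsTime_one hπ hm (left_ne_zero_of_mul h0) (right_ne_zero_of_mul h0)
    ENNReal.one_ne_top a ((meanVisits_mul_of_noOverlap P hm hx a).trans (mul_one _).symm),
    one_div, ENNReal.mul_inv (Or.inr (prod_transition_ne_top P x _)) (Or.inl (π.apply_ne_top _)),
    one_mul, mul_comm (π (x 1))⁻¹]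

theorem lintegral_obsTime_one_of_overlap (hπ : IsTheStationaryDistribution P π) (hm : 1 ≤ m)
    (h0 : π (x 1) * ∏ i ∈ Finset.Ico 1 m, P (x i) (x (i + 1)) ≠ 0) {k : ℕ} (hk : 1 ≤ k)
    (hx : HasOverlapOfSize x m k) (hxk : NoOverlap x k) (a : S) :
    ∫⁻ y, (obsTime x m y 1 : ℝ≥0∞) ∂chainLaw P a + meanHitTime P (x m) (x 1) =
      1 / (π (x 1) * ∏ i ∈ Finset.Ico 1 m, P (x i) (x (i + 1))) +
      1 / (π (x 1) * ∏ i ∈ Finset.Ico 1 k, P (x i) (x (i + 1))) + meanHitTime P a (x 1) := by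
  have hsplit := Finset.prod_Ico_consecutive (fun i => P (x i) (x (i + 1))) hk hx.1.1.le
  have hK := right_ne_zero_of_mul h0
  have hR : ∏ i ∈ Finset.Ico k m, P (x i) (x (i + 1)) ≠ 0 := by
    rw [← hsplit] at hK
    exact right_ne_zero_of_mul hK
  have hRt := prod_transition_ne_top P x (Finset.Ico k m)
  rw [lintegral_obsTime_one hπ hm (left_ne_zero_of_mul h0) hK
    (ENNReal.add_ne_top.2 ⟨ENNReal.one_ne_top, hRt⟩) a (meanVisits_mul_of_overlap P hm hk hx hxk a),
    one_div, one_div,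
    ENNReal.mul_inv (Or.inr (prod_transition_ne_top P x _)) (Or.inl (π.apply_ne_top _)),
    ENNReal.mul_inv (Or.inr (prod_transition_ne_top P x _)) (Or.inl (π.apply_ne_top _)),
    ← mul_add, mul_comm (π (x 1))⁻¹, add_mul, one_mul]
  congr 3
  -- K is the prefix product times R, so R/K is the reciprocal of the prefix product.
  rw [← hsplit, ENNReal.mul_inv (Or.inr hRt) (Or.inr hR), mul_comm, mul_assoc,
    ENNReal.inv_mul_cancel hR hRt, mul_one]

theorem measurableSet_observedInState (x : ℕ → S) (m j : ℕ) (a : S) :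
    MeasurableSet {y : ℕ → S | ObservedInState x m y j a} := by
  rw [observedInState_eq_iUnion]
  exact MeasurableSet.iUnion fun t => (knownAt_observed x m j a t).measurableSet

theorem measurable_waitTime (x : ℕ → S) (m j : ℕ) :
    Measurable fun y : ℕ → S => (waitTime x m y j : ℝ≥0∞) :=
  measurable_toENNReal.comp ((Measurable.of_discrete (f := fun t : ℕ∞ × ℕ∞ => t.1 - t.2)).comp
    ((measurable_obsTime x m (j + 1)).prodMk (measurable_obsTime x m j)))

/-- After each observation the waiting starts afresh. -/
theorem IsMarkovLaw.setLIntegral_waitTime {ν : Measure (ℕ → S)} [IsFiniteMeasure ν]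
    (hν : IsMarkovLaw P ν) (x : ℕ → S) (m j : ℕ) (a : S) :
    ∫⁻ y in {y | ObservedInState x m y j a}, (waitTime x m y j : ℝ≥0∞) ∂ν =
      ν {y | ObservedInState x m y j a} * ∫⁻ y, (obsTime x m y 1 : ℝ≥0∞) ∂chainLaw P a := by
  have hd : Pairwise (Function.onFun Disjoint
      fun t : ℕ => {y : ℕ → S | obsTime x m y j = t} ∩ {y | y t = a}) := fun s t hst =>
    Set.disjoint_left.2 fun y h1 h2 => hst (Nat.cast_injective ((Eq.symm h1.1).trans h2.1))
  have hm := fun t : ℕ => (knownAt_observed x m j a t).measurableSet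
  rw [observedInState_eq_iUnion, lintegral_iUnion hm hd, measure_iUnion hd hm,
    ← ENNReal.tsum_mul_right]
  refine tsum_congr fun t => ?_
  refine Eq.trans ?_ (hν.setLIntegral_shift (knownAt_observed x m j a t) (fun y hy => hy.2)
    (measurable_toENNReal.comp (measurable_obsTime x m 1)))
  exact setLIntegral_congr_fun (hm t) fun y hy => congrArg _ (waitTime_eq hy.1)

theorem IsMarkovChain.isMarkovLaw_map {Ω : Type*} [MeasurableSpace Ω] {μ : Measure Ω}
    {X : ℕ → Ω → S} (hX : IsMarkovChain P X μ) :
    IsMarkovLaw P (μ.map fun ω n => X n ω) := by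
  have mX : Measurable fun ω n => X n ω := measurable_pi_lambda _ hX.1
  refine ⟨fun n => measurable_pi_apply n, fun n s => ?_⟩
  have mcyl : ∀ k : ℕ, MeasurableSet {y : ℕ → S | ∀ i ≤ k, y i = s i} := fun k =>
    (knownAt_of_forall (n := k) fun y z hyz (hy : ∀ i ≤ k, y i = s i) i hi =>
      (hyz i hi).symm.trans (hy i hi)).measurableSet
  rw [Measure.map_apply mX (mcyl _), Measure.map_apply mX (mcyl _)]
  exact hX.2 n s

theorem IsMarkovChain.lintegral_cond_waitTime {Ω : Type*} [MeasurableSpace Ω] {μ : Measure Ω}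
    [IsProbabilityMeasure μ] {X : ℕ → Ω → S} (hX : IsMarkovChain P X μ) {x : ℕ → S} {m j : ℕ}
    {a : S} (hB : μ {ω | ObservedInState x m (fun n => X n ω) j a} ≠ 0) :
    ∫⁻ ω, (waitTime x m (fun n => X n ω) j : ℝ≥0∞)
        ∂(μ[|{ω | ObservedInState x m (fun n => X n ω) j a}]) =
      ∫⁻ y, (obsTime x m y 1 : ℝ≥0∞) ∂chainLaw P a := by
  have mX : Measurable fun ω n => X n ω := measurable_pi_lambda _ hX.1
  have h := hX.isMarkovLaw_map.setLIntegral_waitTime x m j a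
  rw [setLIntegral_map (measurableSet_observedInState x m j a) (measurable_waitTime x m j) mX,
    Measure.map_apply mX (measurableSet_observedInState x m j a)] at h
  rw [ProbabilityTheory.cond, lintegral_smul_measure, smul_eq_mul]
  refine (congrArg _ h).trans ?_
  rw [← mul_assoc]
  exact (congrArg (· * _) (ENNReal.inv_mul_cancel hB (measure_ne_top _ _))).trans (one_mul _)

end MeanWaitingTime

/-! ### The iid case -/

section Iid

variable {S : Type*} [Countable S] [MeasurableSpace S] [MeasurableSingletonClass S]
  {x : ℕ → S} {m : ℕ}

/-- An iid sequence, preceded by a deterministic state, is a Markov chain. -/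
theorem map_iid_eq_chainLaw {Ω : Type*} [MeasurableSpace Ω] {μ : Measure Ω}
    [IsProbabilityMeasure μ] {p : PMF S} {X : ℕ → Ω → S} (hX : ∀ n, 1 ≤ n → Measurable (X n))
    (hind : iIndepFun (fun n : ℕ => X (n + 1)) μ)
    (hp : ∀ n, 1 ≤ n → ∀ a : S, μ {ω | X n ω = a} = p a) (a : S) :
    (Measurable fun (ω : Ω) (n : ℕ) => if n = 0 then a else X n ω) ∧
    μ.map (fun ω n => if n = 0 then a else X n ω) = chainLaw (fun _ => p) a := by
  classical
  set Y : ℕ → Ω → S := fun n ω => if n = 0 then a else X n ω with hY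
  have mY : ∀ n, Measurable (Y n) := fun n => by
    by_cases hn : n = 0
    · simp only [hY, hn, if_true]
      exact measurable_const
    · simp only [hY, hn, if_false]
      exact hX n (by omega)
  have mY' : Measurable fun ω n => Y n ω := measurable_pi_lambda _ mY
  -- Time 0 is deterministic and contributes an indicator; independence gives the product over the
  -- later times.
  have hcyl : ∀ (n : ℕ) (s : ℕ → S), μ {ω | ∀ i ≤ n, Y i ω = s i} =
      (if s 0 = a then 1 else 0) * ∏ i ∈ Finset.range n, p (s (i + 1)) := fun n s => by
    split_ifs with h0
    · have := hind.measure_inter_preimage_eq_mul (Finset.range n)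
        (sets := fun i => {s (i + 1)}) fun i _ => measurableSet_singleton _
      rw [one_mul]
      refine Eq.trans ?_ (this.trans (Finset.prod_congr rfl fun i _ => hp (i + 1) (by omega) _))
      congr 1
      ext ω
      simp only [Set.mem_iInter, Finset.mem_range]
      constructor
      · intro h i hi
        have := h (i + 1) hi
        simpa [hY] using this
      · intro h i hi
        rcases Nat.eq_zero_or_pos i with rfl | hi0
        · simp [hY, h0]
        · have := h (i - 1) (by omega)
          simp only [Nat.sub_add_cancel hi0] at this
          change (if i = 0 then a else X i ω) = s i
          rw [if_neg (by omega)]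
          exact this
    · rw [zero_mul]
      convert measure_empty (μ := μ)
      refine Set.eq_empty_of_forall_notMem fun ω hω => h0 ?_
      have := hω 0 (Nat.zero_le n)
      simpa [hY] using this.symm
  have hch : IsMarkovChain (fun _ => p) Y μ := ⟨mY, fun n s => by
    rw [hcyl, hcyl, Finset.prod_range_succ, mul_assoc]⟩
  refine ⟨mY', (hch.isMarkovLaw_map).ext (chainLaw_isMarkovLaw _ a) fun b => ?_⟩
  rw [Measure.map_apply mY' (knownAt_state (n := 0) le_rfl b).measurableSet]
  by_cases hb : b = a
  · subst hb
    rw [chainLaw_start_eq_one]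
    convert measure_univ (μ := μ)
    exact Set.eq_univ_of_forall fun ω => if_pos rfl
  · have h1 : chainLaw (fun _ => p) a {y | y 0 = b} = 0 := by
      refine measure_mono_null ?_ (chainLaw_start _ a)
      intro y hy h
      exact hb ((Eq.symm hy).trans h)
    rw [h1]
    convert measure_empty (μ := μ)
    refine Set.eq_empty_of_forall_notMem fun ω hω => hb ?_
    exact (Eq.symm hω).trans (if_pos rfl)

/-- If the mean time of the first observation is finite for the chain started at the last letter,
then every observation takes place, and all waiting times have this mean. -/
theorem lintegral_waitTime_of_ne_top {P : S → PMF S} (hm : 1 ≤ m)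
    (hT : ∫⁻ y, (obsTime x m y 1 : ℝ≥0∞) ∂chainLaw P (x m) ≠ ∞) (j : ℕ) :
    ∫⁻ y, (waitTime x m y j : ℝ≥0∞) ∂chainLaw P (x m) =
      ∫⁻ y, (obsTime x m y 1 : ℝ≥0∞) ∂chainLaw P (x m) := by
  have key : ∀ j, (∀ᵐ y ∂chainLaw P (x m), ObservedInState x m y j (x m)) →
      ∫⁻ y, (waitTime x m y j : ℝ≥0∞) ∂chainLaw P (x m) =
        ∫⁻ y, (obsTime x m y 1 : ℝ≥0∞) ∂chainLaw P (x m) := fun j hj => by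
    have h := (chainLaw_isMarkovLaw P (x m)).setLIntegral_waitTime x m j (x m)
    rwa [(prob_compl_eq_zero_iff (measurableSet_observedInState x m j (x m))).1 hj, one_mul,
      Measure.restrict_eq_self_of_ae_mem (s := {y | ObservedInState x m y j (x m)}) hj] at h
  refine key j ?_
  induction j with
  | zero =>
    filter_upwards [chainLaw_start P (x m)] with y hy
    exact ⟨0, rfl, hy⟩
  | succ j ih =>
    have hfin := key j ih
    filter_upwards [ih, ae_lt_top (measurable_waitTime x m j) (hfin ▸ hT)] with y hy hlt
    obtain ⟨t, ht, -⟩ := hy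
    -- A finite mean waiting time makes the next observation almost sure, which carries the
    -- induction.
    have hne : obsTime x m y (j + 1) ≠ ⊤ := by
      rw [waitTime_eq ht] at hlt
      rw [obsTime_succ_eq_add ht]
      refine WithTop.add_ne_top.2 ⟨ENat.natCast_ne_top t, fun htop => ?_⟩
      rw [htop] at hlt
      exact lt_irrefl _ hlt
    obtain ⟨u, hu⟩ := ENat.ne_top_iff_exists.1 hne
    exact ⟨u, hu.symm, obsTime_succ_state hm hu.symm⟩

theorem lintegral_waitTime_iid {Ω : Type*} [MeasurableSpace Ω] {μ : Measure Ω}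
    [IsProbabilityMeasure μ] {p : PMF S} {X : ℕ → Ω → S} (hX : ∀ n, 1 ≤ n → Measurable (X n))
    (hind : iIndepFun (fun n : ℕ => X (n + 1)) μ)
    (hp : ∀ n, 1 ≤ n → ∀ a : S, μ {ω | X n ω = a} = p a) (hm : 1 ≤ m)
    (h0 : ∏ i ∈ Finset.Icc 1 m, p (x i) ≠ 0) {C : ℝ≥0∞} (hC : C ≠ ∞)
    (h : ∫⁻ y, (obsTime x m y 1 : ℝ≥0∞) ∂chainLaw (fun _ => p) (x m) +
      meanHitTime (fun _ => p) (x m) (x 1) = C + meanHitTime (fun _ => p) (x m) (x 1)) (j : ℕ) :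
    ∫⁻ ω, (waitTime x m (fun n => X n ω) j : ℝ≥0∞) ∂μ = C := by
  rw [prod_Icc_eq_mul _ _ hm] at h0
  have hfin := (isTheStationaryDistribution_const p).meanHitTime_pattern_ne_top hm
    (left_ne_zero_of_mul h0) (right_ne_zero_of_mul h0)
  have hT := (ENNReal.add_left_inj hfin).1 h
  -- The state at time 0 is replaced by x_m, which alters no waiting time.
  obtain ⟨mY, hY⟩ := map_iid_eq_chainLaw hX hind hp (x m)
  rw [← hT, ← lintegral_waitTime_of_ne_top hm (hT ▸ hC) j, ← hY,
    lintegral_map (measurable_waitTime x m j) mY]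
  refine lintegral_congr fun ω => congrArg _ (waitTime_congr (fun i hi => ?_) j)
  rw [if_neg (by omega)]

end Iid
end PatternOccurrence

open PatternOccurrence in
theorem mainTheorem1
    {S : Type*} [Countable S] [MeasurableSpace S] [MeasurableSingletonClass S]
    {Ω : Type*} [MeasurableSpace Ω] (μ : Measure Ω) [IsProbabilityMeasure μ]
    (m : ℕ) (hm : 1 ≤ m) (x : ℕ → S) :
    -- Markov chains; the waiting starts in the state `x 0`, the pattern is `(x 1, …, x m)`
    (∀ (P : S → PMF S) (π : PMF S) (X : ℕ → Ω → S),
      IsTheStationaryDistribution P π → IsMarkovChain P X μ →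
      π (x 1) * ∏ i ∈ Finset.Ico 1 m, P (x i) (x (i + 1)) ≠ 0 →
      meanHitTime P (x m) (x 1) ≠ ∞ ∧
      ∀ j : ℕ, μ {ω | ObservedInState x m (fun n => X n ω) j (x 0)} ≠ 0 →
        (NoOverlap x m →
          ((∫⁻ ω, (waitTime x m (fun n => X n ω) j : ℝ≥0∞)
              ∂(μ[|{ω | ObservedInState x m (fun n => X n ω) j (x 0)}]) : ℝ≥0∞) : EReal) =
            ((1 / (π (x 1) * ∏ i ∈ Finset.Ico 1 m, P (x i) (x (i + 1))) : ℝ≥0∞) : EReal)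
              + (meanHitTime P (x 0) (x 1) : EReal) - (meanHitTime P (x m) (x 1) : EReal)) ∧
        (∀ k : ℕ, 1 ≤ k → HasOverlapOfSize x m k → NoOverlap x k →
          ((∫⁻ ω, (waitTime x m (fun n => X n ω) j : ℝ≥0∞)
              ∂(μ[|{ω | ObservedInState x m (fun n => X n ω) j (x 0)}]) : ℝ≥0∞) : EReal) =
            ((1 / (π (x 1) * ∏ i ∈ Finset.Ico 1 m, P (x i) (x (i + 1))) : ℝ≥0∞) : EReal)
              + ((1 / (π (x 1) * ∏ i ∈ Finset.Ico 1 k, P (x i) (x (i + 1))) : ℝ≥0∞) : EReal)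
              + (meanHitTime P (x 0) (x 1) : EReal) - (meanHitTime P (x m) (x 1) : EReal))) ∧
    -- iid sequences `X 1, X 2, …` with distribution `p`
    (∀ (p : PMF S) (X : ℕ → Ω → S),
      (∀ n, 1 ≤ n → Measurable (X n)) → iIndepFun (fun n : ℕ => X (n + 1)) μ →
      (∀ n, 1 ≤ n → ∀ a : S, μ {ω | X n ω = a} = p a) →
      ∏ i ∈ Finset.Icc 1 m, p (x i) ≠ 0 →
      ∀ j : ℕ,
        (NoOverlap x m →
          ∫⁻ ω, (waitTime x m (fun n => X n ω) j : ℝ≥0∞) ∂μ =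
            1 / (∏ i ∈ Finset.Icc 1 m, p (x i))) ∧
        (∀ k : ℕ, 1 ≤ k → HasOverlapOfSize x m k → NoOverlap x k →
          ∫⁻ ω, (waitTime x m (fun n => X n ω) j : ℝ≥0∞) ∂μ =
            1 / (∏ i ∈ Finset.Icc 1 m, p (x i)) + 1 / (∏ i ∈ Finset.Icc 1 k, p (x i)))) := by
  refine ⟨fun P π X hπ hX h0 => ?_, fun p X hX hind hp h0 j => ?_⟩
  · have hfin := hπ.meanHitTime_pattern_ne_top hm (left_ne_zero_of_mul h0) (right_ne_zero_of_mul h0)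
    refine ⟨hfin, fun j hB => ⟨fun hx => ?_, fun k hk hx hxk => ?_⟩⟩
    · rw [hX.lintegral_cond_waitTime hB, ← EReal.coe_ennreal_add]
      exact ereal_coe_eq_sub hfin (lintegral_obsTime_one_of_noOverlap hπ hm h0 hx _)
    · rw [hX.lintegral_cond_waitTime hB, ← EReal.coe_ennreal_add, ← EReal.coe_ennreal_add]
      exact ereal_coe_eq_sub hfin (lintegral_obsTime_one_of_overlap hπ hm h0 hk hx hxk _)
  · have h0' := h0
    rw [prod_Icc_eq_mul _ _ hm] at h0'
    have hinv : 1 / ∏ i ∈ Finset.Icc 1 m, p (x i) ≠ ∞ := by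
      rw [one_div]
      exact ENNReal.inv_ne_top.2 h0
    refine ⟨fun hx => ?_, fun k hk hx hxk => ?_⟩
    · refine lintegral_waitTime_iid hX hind hp hm h0 hinv ?_ j
      rw [prod_Icc_eq_mul _ _ hm]
      exact lintegral_obsTime_one_of_noOverlap (isTheStationaryDistribution_const p) hm h0' hx _
    · refine lintegral_waitTime_iid hX hind hp hm h0 (ENNReal.add_ne_top.2 ⟨hinv, ?_⟩) ?_ j
      · rw [one_div]
        refine ENNReal.inv_ne_top.2 (Finset.prod_ne_zero_iff.2 fun i hi => ?_)
        have hi' := Finset.mem_Icc.1 hi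
        exact Finset.prod_ne_zero_iff.1 h0 i
          (Finset.mem_Icc.2 ⟨hi'.1, hi'.2.trans hx.1.1.le⟩)
      · rw [prod_Icc_eq_mul _ _ hm, prod_Icc_eq_mul _ _ hk]
        exact lintegral_obsTime_one_of_overlap (isTheStationaryDistribution_const p) hm h0' hk hx
          hxk _
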